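/- Let $S=(-\frac{\pi}{2},\frac{\pi}{2})^2\subset\mathbb{R}^2$ and let $h<0$. A Robin eigenvalue of the Laplacian on $S$ with parameter $h$ is a real number $\lambda$ for which there is a nonzero $u\in H^1(S)$, called an eigenfunction for $\lambda$, that solves $-\Delta u=\lambda u$ in $S$ and $\frac{\partial u}{\partial\nu}+hu=0$ on $\partial S$ in the weak sense, where $\nu$ is the outward unit normal; that is, $\int_S\nabla u\cdot\nabla v\,dx+h\int_{\partial S}uv\,d\sigma=\lambda\int_S uv\,dx$ for all $v\in H^1(S)$, with traces taken on $\partial S$. Let $\lambda_{1,h}(S)\le\lambda_{2,h}(S)\le\cdots$ be these eigenvalues in nondecreasing order, repeated according to multiplicity. The eigenvalue $\lambda_{k,h}(S)$ is called Courant-sharp if it has an eigenfunction (taken continuous in $S$) with exactly $k$ nodal domains, i.e. such that $\{x\in S: u(x)\neq 0\}$ has exactly $k$ connected components. Then, for every $h<0$, the eigenvalues $\lambda_{4,h}(S)$ and $\lambda_{5,h}(S)$ are Courant-sharp. -/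

import Mathlib

open Real Set Filter Topology MeasureTheory
open scoped ENNReal ContDiff

noncomputable section

namespace RobinSquare

/-- The open square `(-π/2, π/2)²`. -/
def square : Set (ℝ × ℝ) := Ioo (-(π / 2)) (π / 2) ×ˢ Ioo (-(π / 2)) (π / 2)

/-- Lebesgue measure on the open square. -/
def area : Measure (ℝ × ℝ) := volume.restrict square

/-- Arc length on the boundary of the square: the sum of the length measures of the four edges. -/
def arcLength : Measure (ℝ × ℝ) :=
  let I : Measure ℝ := volume.restrict (Icc (-(π / 2)) (π / 2))
  I.map (fun y => (-(π / 2), y)) + I.map (fun y => (π / 2, y)) +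
    I.map (fun x => (x, -(π / 2))) + I.map (fun x => (x, π / 2))

/-- The partial derivative of `φ` at `p` with respect to the first variable. -/
def dx (φ : ℝ × ℝ → ℝ) (p : ℝ × ℝ) : ℝ := fderiv ℝ φ p (1, 0)

/-- The partial derivative of `φ` at `p` with respect to the second variable. -/
def dy (φ : ℝ × ℝ → ℝ) (p : ℝ × ℝ) : ℝ := fderiv ℝ φ p (0, 1)

/-- `u` belongs to `H¹` of the square, with weak partial derivatives `g₁` and `g₂`. -/
structure IsH1 (u g₁ g₂ : ℝ × ℝ → ℝ) : Prop where
  memLp : MemLp u 2 area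
  memLp_dx : MemLp g₁ 2 area
  memLp_dy : MemLp g₂ 2 area
  weak_dx : ∀ φ : ℝ × ℝ → ℝ, ContDiff ℝ ∞ φ → HasCompactSupport φ → tsupport φ ⊆ square →
    ∫ p, u p * dx φ p ∂area = -∫ p, g₁ p * φ p ∂area
  weak_dy : ∀ φ : ℝ × ℝ → ℝ, ContDiff ℝ ∞ φ → HasCompactSupport φ → tsupport φ ⊆ square →
    ∫ p, u p * dy φ p ∂area = -∫ p, g₂ p * φ p ∂area

/-- `t ∈ L²(∂S)` is the boundary trace of the `H¹` function `u` with weak gradient `(g₁, g₂)`: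
it is the `L²(∂S)`-limit of the boundary values of smooth functions that converge to `u` in
`H¹(S)`. -/
def IsTrace (u g₁ g₂ t : ℝ × ℝ → ℝ) : Prop :=
  MemLp t 2 arcLength ∧
  ∃ φ : ℕ → ℝ × ℝ → ℝ, (∀ n, ContDiff ℝ ∞ (φ n)) ∧
    Tendsto (fun n => eLpNorm (fun p => φ n p - u p) 2 area) atTop (𝓝 0) ∧
    Tendsto (fun n => eLpNorm (fun p => dx (φ n) p - g₁ p) 2 area) atTop (𝓝 0) ∧
    Tendsto (fun n => eLpNorm (fun p => dy (φ n) p - g₂ p) 2 area) atTop (𝓝 0) ∧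
    Tendsto (fun n => eLpNorm (fun p => φ n p - t p) 2 arcLength) atTop (𝓝 0)

/-- `u` is an eigenfunction, for the eigenvalue `μ`, of the Robin Laplacian with parameter `h` on
the square: it is a nonzero element of `H¹` that solves `-Δu = μu` in the square and
`∂u/∂ν + hu = 0` on its boundary in the weak sense. -/
def IsRobinEigenfunction (h μ : ℝ) (u : ℝ × ℝ → ℝ) : Prop :=
  (¬ u =ᵐ[area] 0) ∧
  ∃ g₁ g₂ t : ℝ × ℝ → ℝ, IsH1 u g₁ g₂ ∧ IsTrace u g₁ g₂ t ∧
    ∀ v v₁ v₂ s : ℝ × ℝ → ℝ, IsH1 v v₁ v₂ → IsTrace v v₁ v₂ s →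
      ∫ p, (g₁ p * v₁ p + g₂ p * v₂ p) ∂area + h * ∫ p, t p * s p ∂arcLength =
        μ * ∫ p, u p * v p ∂area

/-- The number, counted with multiplicity, of Robin eigenvalues in the set `A`, that is, the
dimension in `L²` of the span of the eigenfunctions whose eigenvalue lies in `A`. -/
def eigenvalueCount (h : ℝ) (A : Set ℝ) : Cardinal :=
  Module.rank ℝ (Submodule.span ℝ
    {u : Lp ℝ 2 area | ∃ μ ∈ A, IsRobinEigenfunction h μ (u : ℝ × ℝ → ℝ)})

/-- `l` is the `k`-th Robin eigenvalue (`k ≥ 1`), when the eigenvalues are listed in nondecreasing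
order and repeated according to their multiplicities: fewer than `k` eigenvalues are less than
`l`, and at least `k` are at most `l`. -/
def IsNthEigenvalue (h : ℝ) (k : ℕ) (l : ℝ) : Prop :=
  eigenvalueCount h (Iio l) < k ∧ (k : Cardinal) ≤ eigenvalueCount h (Iic l)

/-- The number of nodal domains of `u`, the connected components of the complement of its zero
set in the open square. -/
def nodalCount (u : ℝ × ℝ → ℝ) : ℕ∞ :=
  ENat.card (ConnectedComponents {p : ℝ × ℝ // p ∈ square ∧ u p ≠ 0})

/-- The `k`-th Robin eigenvalue of the square is Courant-sharp: it has an eigenfunction (taken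
in its continuous representative) with exactly `k` nodal domains. -/
def IsCourantSharp (h : ℝ) (k : ℕ) : Prop :=
  ∃ l : ℝ, IsNthEigenvalue h k l ∧
    ∃ u : ℝ × ℝ → ℝ, ContinuousOn u square ∧ IsRobinEigenfunction h l u ∧ nodalCount u = k

end RobinSquare

end

/-! Separation of variables reduces everything to three Robin modes on the interval: `e₀ =
cosh(ax)`, an odd mode `e₁` (a sine, the identity or a hyperbolic sine, according as `K = -hπ/2` is
less than, equal to or greater than 1), and `e₂ = cos(bx)` with `1 < b < 2`, up to normalization.
Their eigenvalues satisfy `μ₀ < μ₁ < μ₂`, and elementary estimates of the three transcendental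
equations give the decisive inequality `2μ₁ ≤ μ₀ + μ₂`. Hence the spectrum of the square starts with
`2μ₀`, then `μ₀ + μ₁` twice, then `2μ₁`, then `μ₀ + μ₂`.

That nothing else lies below `μ₀ + μ₂` is proved without completeness of the modes. On the interval,
Picone's inequality for `e₂` bounds the Robin form from below by `μ₂` on functions vanishing at the
zeros of `e₂`; any function is brought to this form by subtracting multiples of `e₀` and `e₁`
(`ModeTriple.lower_bound`). Integrating over slices and using a Bessel inequality (`bessel_area`)
gives the bound on the square (`lower_bound_area`), which density carries over to `H¹`. An
eigenfunction below `μ₀ + μ₂` must then lie in the span of the four lowest products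
(`eq_sum_of_lt`), and counting dimensions fixes the indices 4 and 5.

For the fourth eigenvalue the function `e₁(x)e₁(y)` vanishes exactly on the axes, so it has four
nodal domains. For the fifth, `e₀(x)e₂(y) + e₂(x)e₀(y)` has the sign of `g(x) + g(y)` with `g =
e₂/e₀` even and decreasing on `[0, π/2]`. Because `g(0) + g(π/2) > 0 > g(π/2)`, it is positive on
both axes and negative near the corners: one positive domain and one negative domain at each corner.
-/

noncomputable section

namespace RobinSquare

/-! ### The Robin problem on the interval and Picone's inequality -/

/-- Lebesgue measure on the interval `(-π/2, π/2)`. -/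
def edge : Measure ℝ := volume.restrict (Ioo (-(π / 2)) (π / 2))

instance : IsFiniteMeasure edge := by
  unfold edge; infer_instance

lemma integral_edge (f : ℝ → ℝ) : ∫ x, f x ∂edge = ∫ x in (-(π / 2))..(π / 2), f x := by
  rw [intervalIntegral.integral_of_le (by linarith [pi_pos]), edge,
    Measure.restrict_congr_set Ioo_ae_eq_Ioc]

lemma integrable_edge {f : ℝ → ℝ} (hf : Continuous f) : Integrable f edge :=
  (hf.integrableOn_Icc (a := -(π / 2)) (b := π / 2)).mono_set Ioo_subset_Icc_self

/-- `e` is an eigenfunction, for the eigenvalue `μ`, of the Robin problem with parameter `h` on the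
interval `(-π/2, π/2)`. -/
structure IsMode (h μ : ℝ) (e : ℝ → ℝ) : Prop where
  contDiff : ContDiff ℝ ∞ e
  deriv_deriv : ∀ x, deriv (deriv e) x = -(μ * e x)
  right : deriv e (π / 2) = -(h * e (π / 2))
  left : deriv e (-(π / 2)) = h * e (-(π / 2))

namespace IsMode

variable {h μ ν : ℝ} {e k f : ℝ → ℝ}

lemma continuous (he : IsMode h μ e) : Continuous e := he.contDiff.continuous

lemma hasDerivAt (he : IsMode h μ e) (x : ℝ) : HasDerivAt e (deriv e x) x :=
  (he.contDiff.differentiable (by simp) x).hasDerivAt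

lemma contDiff_deriv (he : IsMode h μ e) : ContDiff ℝ ∞ (deriv e) :=
  (contDiff_infty_iff_deriv.1 he.contDiff).2

lemma hasDerivAt_deriv (he : IsMode h μ e) (x : ℝ) : HasDerivAt (deriv e) (-(μ * e x)) x := by
  rw [← he.deriv_deriv x]
  exact (he.contDiff_deriv.differentiable (by simp) x).hasDerivAt

lemma const_mul (he : IsMode h μ e) (c : ℝ) : IsMode h μ (fun x => c * e x) := by
  have h1 : deriv (fun x => c * e x) = fun x => c * deriv e x :=
    funext fun x => ((he.hasDerivAt x).const_mul c).deriv
  refine ⟨contDiff_const.mul he.contDiff, fun x => ?_, ?_, ?_⟩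
  · rw [h1, ((he.hasDerivAt_deriv x).const_mul c).deriv]; ring
  · simp only [h1, he.right]; ring
  · simp only [h1, he.left]; ring

/-- The weak form of the one-dimensional Robin problem. -/
lemma weak (he : IsMode h μ e) (hf : ContDiff ℝ 1 f) :
    ∫ x, deriv e x * deriv f x ∂edge + h * (e (π / 2) * f (π / 2) + e (-(π / 2)) * f (-(π / 2)))
      = μ * ∫ x, e x * f x ∂edge := by
  have hf' : Continuous (deriv f) := hf.continuous_deriv le_rfl
  have key := intervalIntegral.integral_mul_deriv_eq_deriv_mul (a := -(π / 2)) (b := π / 2)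
    (u := deriv e) (v := f) (u' := fun x => -(μ * e x)) (v' := deriv f)
    (fun x _ => he.hasDerivAt_deriv x)
    (fun x _ => (hf.differentiable one_ne_zero x).hasDerivAt)
    ((he.continuous.const_mul μ).neg.intervalIntegrable _ _) (hf'.intervalIntegrable _ _)
  rw [integral_edge, integral_edge, key, he.right, he.left,
    ← intervalIntegral.integral_const_mul]
  have : ∫ x in (-(π / 2))..(π / 2), -(μ * e x) * f x
      = -∫ x in (-(π / 2))..(π / 2), μ * (e x * f x) := by
    rw [← intervalIntegral.integral_neg]
    congr 1; ext x; ring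
  rw [this]; ring

lemma integral_mul_eq_zero (he : IsMode h μ e) (hk : IsMode h ν k) (hne : μ ≠ ν) :
    ∫ x, e x * k x ∂edge = 0 := by
  have h1 := he.weak (hk.contDiff.of_le (by simp))
  have h2 := hk.weak (he.contDiff.of_le (by simp))
  simp only [mul_comm (deriv k _), mul_comm (k _)] at h2
  have : (μ - ν) * ∫ x, e x * k x ∂edge = 0 := by linarith
  exact (mul_eq_zero.1 this).resolve_left (sub_ne_zero.2 hne)

/-- The Picone inequality, for functions vanishing at the (simple) zeros of the mode. -/
lemma picone (he : IsMode h μ e) (hf : ContDiff ℝ 1 f)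
    (hz : ∀ x ∈ Icc (-(π / 2)) (π / 2), e x = 0 → deriv e x ≠ 0 ∧ f x = 0) :
    μ * ∫ x, f x ^ 2 ∂edge
      ≤ ∫ x, deriv f x ^ 2 ∂edge + h * (f (π / 2) ^ 2 + f (-(π / 2)) ^ 2) := by
  have hfd : ∀ x, HasDerivAt f (deriv f x) x := fun x => (hf.differentiable one_ne_zero x).hasDerivAt
  have hf' : Continuous (deriv f) := hf.continuous_deriv le_rfl
  have hpi : -(π / 2) ≤ π / 2 := by linarith [pi_pos]
  -- Where `e ≠ 0`, the derivative of this quotient is `f'² - μf² - (f' - (e'/e)f)²`, and its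
  -- boundary values are exactly the Robin boundary terms.
  set Φ : ℝ → ℝ := fun x => deriv e x * f x ^ 2 / e x with hΦ
  have hder : ∀ x ∈ Icc (-(π / 2)) (π / 2), ∃ d, HasDerivAt Φ d x ∧
      d ≤ deriv f x ^ 2 - μ * f x ^ 2 := by
    intro x hx
    by_cases hex : e x = 0
    · obtain ⟨h1, h2⟩ := hz x hx hex
      -- At a common zero, division by zero gives `Φ x = 0`, the value of the continuous extension.
      -- The difference quotient is `e'(y)` times the squared slope of `f` over the slope of `e`,
      -- and so tends to `f'(x)²`.
      refine ⟨deriv f x ^ 2, ?_, by simp [h2]⟩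
      rw [hasDerivAt_iff_tendsto_slope]
      have t1 := (hfd x).tendsto_slope
      have t2 := (he.hasDerivAt x).tendsto_slope
      have t3 : Tendsto (deriv e) (𝓝[≠] x) (𝓝 (deriv e x)) :=
        (he.hasDerivAt_deriv x).continuousAt.tendsto.mono_left nhdsWithin_le_nhds
      have t4 := (t3.mul (t1.pow 2)).div t2 h1
      have e1 : deriv e x * deriv f x ^ 2 / deriv e x = deriv f x ^ 2 := by field_simp
      rw [e1] at t4
      refine t4.congr' ?_
      filter_upwards [self_mem_nhdsWithin] with y hy
      have hyx : y - x ≠ 0 := sub_ne_zero.2 hy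
      simp only [slope_def_field, hΦ, h2, hex, Pi.div_apply, sub_zero]
      by_cases hey : e y = 0
      · simp [hey]
      · field_simp
        simp
    · refine ⟨_, (((he.hasDerivAt_deriv x).mul ((hfd x).pow 2)).div (he.hasDerivAt x) hex), ?_⟩
      rw [div_le_iff₀ (by positivity)]
      simp only [Pi.pow_apply, Pi.mul_apply]
      norm_num
      nlinarith [sq_nonneg (deriv f x * e x - deriv e x * f x)]
  choose! d hd1 hd2 using hder
  -- This one-sided form of the fundamental theorem requires integrability of the upper bound only,
  -- not of the derivative of `Φ`.
  have key := intervalIntegral.sub_le_integral_of_hasDeriv_right_of_le (g := Φ) (g' := d)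
    (φ := fun x => deriv f x ^ 2 - μ * f x ^ 2) hpi
    (fun x hx => (hd1 x hx).continuousAt.continuousWithinAt)
    (fun x hx => (hd1 x (Ioo_subset_Icc_self hx)).hasDerivWithinAt)
    (by apply Continuous.integrableOn_Icc; have := hf.continuous; fun_prop)
    (fun x hx => hd2 x (Ioo_subset_Icc_self hx))
  have hr : Φ (π / 2) = -(h * f (π / 2) ^ 2) := by
    simp only [hΦ]
    by_cases h0 : e (π / 2) = 0
    · simp [(hz _ (right_mem_Icc.2 hpi) h0).2]
    · rw [he.right]; field_simp
  have hl : Φ (-(π / 2)) = h * f (-(π / 2)) ^ 2 := by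
    simp only [hΦ]
    by_cases h0 : e (-(π / 2)) = 0
    · simp [(hz _ (left_mem_Icc.2 hpi) h0).2]
    · rw [he.left]; field_simp
  have hf0 := hf.continuous
  rw [hr, hl, ← integral_edge, integral_sub (integrable_edge (by fun_prop))
    (integrable_edge (by fun_prop)), integral_const_mul] at key
  linarith

end IsMode

/-! ### Three modes and the spectral bound on the interval -/

lemma integral_edge_sq_sub {f p q : ℝ → ℝ} (hf : Continuous f) (hp : Continuous p)
    (hq : Continuous q) (α β : ℝ) :
    ∫ x, (f x - α * p x - β * q x) ^ 2 ∂edge = ∫ x, f x ^ 2 ∂edge + α ^ 2 * ∫ x, p x ^ 2 ∂edge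
      + β ^ 2 * ∫ x, q x ^ 2 ∂edge - 2 * α * ∫ x, p x * f x ∂edge - 2 * β * ∫ x, q x * f x ∂edge
      + 2 * α * β * ∫ x, p x * q x ∂edge := by
  simp only [← integral_const_mul]
  rw [← integral_add (integrable_edge (by fun_prop)) (integrable_edge (by fun_prop)),
    ← integral_add (integrable_edge (by fun_prop)) (integrable_edge (by fun_prop)),
    ← integral_sub (integrable_edge (by fun_prop)) (integrable_edge (by fun_prop)),
    ← integral_sub (integrable_edge (by fun_prop)) (integrable_edge (by fun_prop)),
    ← integral_add (integrable_edge (by fun_prop)) (integrable_edge (by fun_prop))]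
  congr 1; ext x; ring

/-- Three one-dimensional Robin modes, the first two of them being the lowest even and the lowest
odd one, with the shape that determines the nodal domains of their products. -/
structure ModeTriple (h μ₀ μ₁ μ₂ : ℝ) (e₀ e₁ e₂ : ℝ → ℝ) : Prop where
  mode₀ : IsMode h μ₀ e₀
  mode₁ : IsMode h μ₁ e₁
  mode₂ : IsMode h μ₂ e₂
  lt : μ₀ < μ₁
  gap : 2 * μ₁ ≤ μ₀ + μ₂
  norm₀ : ∫ x, e₀ x ^ 2 ∂edge = 1
  norm₁ : ∫ x, e₁ x ^ 2 ∂edge = 1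
  norm₂ : ∫ x, e₂ x ^ 2 ∂edge = 1
  even₀ : ∀ x, e₀ (-x) = e₀ x
  odd₁ : ∀ x, e₁ (-x) = -e₁ x
  even₂ : ∀ x, e₂ (-x) = e₂ x
  pos₀ : ∀ x, 0 < e₀ x
  pos₁ : ∀ x ∈ Ioc 0 (π / 2), 0 < e₁ x
  simple₂ : ∀ x, e₂ x = 0 → deriv e₂ x ≠ 0
  anti : StrictAntiOn (fun x => e₂ x / e₀ x) (Icc 0 (π / 2))
  corner : e₂ (π / 2) / e₀ (π / 2) < 0
  centre : 0 < e₂ 0 / e₀ 0 + e₂ (π / 2) / e₀ (π / 2)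

namespace ModeTriple

variable {h μ₀ μ₁ μ₂ : ℝ} {e₀ e₁ e₂ : ℝ → ℝ}

lemma lt' (H : ModeTriple h μ₀ μ₁ μ₂ e₀ e₁ e₂) : μ₁ < μ₂ := by linarith [H.lt, H.gap]

lemma orth₀₁ (H : ModeTriple h μ₀ μ₁ μ₂ e₀ e₁ e₂) : ∫ x, e₀ x * e₁ x ∂edge = 0 :=
  H.mode₀.integral_mul_eq_zero H.mode₁ H.lt.ne

lemma orth₀₂ (H : ModeTriple h μ₀ μ₁ μ₂ e₀ e₁ e₂) : ∫ x, e₀ x * e₂ x ∂edge = 0 :=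
  H.mode₀.integral_mul_eq_zero H.mode₂ (H.lt.trans H.lt').ne

lemma orth₁₂ (H : ModeTriple h μ₀ μ₁ μ₂ e₀ e₁ e₂) : ∫ x, e₁ x * e₂ x ∂edge = 0 :=
  H.mode₁.integral_mul_eq_zero H.mode₂ H.lt'.ne

lemma continuous_ratio (H : ModeTriple h μ₀ μ₁ μ₂ e₀ e₁ e₂) :
    Continuous (fun x => e₂ x / e₀ x) :=
  H.mode₂.continuous.div H.mode₀.continuous fun x => (H.pos₀ x).ne'

/-- The even ratio `e₂/e₀` falls strictly from a positive to a negative value on `[0, π/2]`. Two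
zeros at most means that two free coefficients suffice to meet the vanishing condition of `picone`.
-/
lemma exists_zero (H : ModeTriple h μ₀ μ₁ μ₂ e₀ e₁ e₂) :
    ∃ z ∈ Ioc 0 (π / 2), ∀ x ∈ Icc (-(π / 2)) (π / 2), e₂ x = 0 → x = z ∨ x = -z := by
  have hpi := pi_pos
  obtain ⟨z, hz, hz0⟩ := intermediate_value_Icc' (by positivity : (0 : ℝ) ≤ π / 2)
    H.continuous_ratio.continuousOn
    (show (0 : ℝ) ∈ Icc _ _ from ⟨H.corner.le, by linarith [H.corner, H.centre]⟩)
  have uniq : ∀ y ∈ Icc 0 (π / 2), e₂ y = 0 → y = z := fun y hy hy0 =>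
    H.anti.injOn hy hz (by simp only at hz0 ⊢; rw [hz0, hy0, zero_div])
  refine ⟨z, ⟨hz.1.lt_of_ne ?_, hz.2⟩, fun x hx hx0 => ?_⟩
  · rintro rfl
    simp only at hz0
    linarith [H.corner, H.centre]
  · rcases le_total 0 x with h0 | h0
    · exact Or.inl (uniq x ⟨h0, hx.2⟩ hx0)
    · right
      have := uniq (-x) ⟨by linarith, by linarith [hx.1]⟩ (by rw [H.even₂, hx0])
      linarith

/-- The spectral lower bound for the one-dimensional Robin form. -/
lemma lower_bound (H : ModeTriple h μ₀ μ₁ μ₂ e₀ e₁ e₂) {f : ℝ → ℝ} (hf : ContDiff ℝ 1 f) :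
    μ₂ * ∫ x, f x ^ 2 ∂edge + (μ₀ - μ₂) * (∫ x, e₀ x * f x ∂edge) ^ 2
        + (μ₁ - μ₂) * (∫ x, e₁ x * f x ∂edge) ^ 2
      ≤ ∫ x, deriv f x ^ 2 ∂edge + h * (f (π / 2) ^ 2 + f (-(π / 2)) ^ 2) := by
  obtain ⟨z, hz, hzero⟩ := H.exists_zero
  have h0 := H.pos₀ z
  have h1 := H.pos₁ z hz
  -- The even part of `f` at `z` is matched by `e₀`, the odd part by `e₁`. These are not the Fourier
  -- coefficients of `f`; the discrepancy only adds squares of the favourable sign (`s0`, `s1`).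
  set α := (f z + f (-z)) / (2 * e₀ z) with hα
  set β := (f z - f (-z)) / (2 * e₁ z) with hβ
  set g : ℝ → ℝ := fun x => f x - α * e₀ x - β * e₁ x with hg
  have c0 : ContDiff ℝ 1 e₀ := H.mode₀.contDiff.of_le (by simp)
  have c1 : ContDiff ℝ 1 e₁ := H.mode₁.contDiff.of_le (by simp)
  have hgc : ContDiff ℝ 1 g := by fun_prop
  have hgz : g z = 0 := by
    simp only [hg, hα, hβ]; field_simp; ring
  have hgz' : g (-z) = 0 := by
    simp only [hg, hα, hβ, H.even₀, H.odd₁]; field_simp; ring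
  have hdg : deriv g = fun x => deriv f x - α * deriv e₀ x - β * deriv e₁ x := by
    ext x
    exact (((hf.differentiable one_ne_zero x).hasDerivAt.sub ((H.mode₀.hasDerivAt x).const_mul α)).sub
      ((H.mode₁.hasDerivAt x).const_mul β)).deriv
  have key := H.mode₂.picone hgc (fun x hx hx0 => ⟨H.simple₂ x hx0, by
    rcases hzero x hx hx0 with rfl | rfl <;> assumption⟩)
  rw [hdg] at key
  simp only [hg] at key
  rw [integral_edge_sq_sub hf.continuous H.mode₀.continuous H.mode₁.continuous,
    integral_edge_sq_sub (hf.continuous_deriv le_rfl) H.mode₀.contDiff_deriv.continuous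
    H.mode₁.contDiff_deriv.continuous] at key
  have w0 := H.mode₀.weak hf
  have w1 := H.mode₁.weak hf
  have w00 := H.mode₀.weak c0
  have w11 := H.mode₁.weak c1
  have w01 := H.mode₀.weak c1
  simp only [← sq, H.norm₀, H.norm₁, H.orth₀₁] at w00 w11 w01 key
  set A := ∫ x, e₀ x * f x ∂edge
  set B := ∫ x, e₁ x * f x ∂edge
  have s0 : (μ₀ - μ₂) * (α - A) ^ 2 ≤ 0 :=
    mul_nonpos_of_nonpos_of_nonneg (by linarith [H.lt, H.lt']) (sq_nonneg _)
  have s1 : (μ₁ - μ₂) * (β - B) ^ 2 ≤ 0 :=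
    mul_nonpos_of_nonpos_of_nonneg (by linarith [H.lt, H.lt']) (sq_nonneg _)
  linear_combination key + s0 + s1 + α ^ 2 * w00 + β ^ 2 * w11 + 2 * α * β * w01
    - 2 * α * w0 - 2 * β * w1

end ModeTriple


/-! ### Existence of the three modes and estimates of their frequencies -/

lemma exists_normalization {e : ℝ → ℝ} (he : Continuous e) {x : ℝ}
    (hx : x ∈ Icc (-(π / 2)) (π / 2)) (h0 : e x ≠ 0) :
    ∃ c > 0, ∫ y, (c * e y) ^ 2 ∂edge = 1 := by
  have hpos : 0 < ∫ y, e y ^ 2 ∂edge := by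
    rw [integral_edge]
    exact intervalIntegral.integral_pos (by linarith [pi_pos]) (he.pow 2).continuousOn
      (fun y _ => sq_nonneg _) ⟨x, hx, by positivity⟩
  refine ⟨(√(∫ y, e y ^ 2 ∂edge))⁻¹, by positivity, ?_⟩
  simp only [mul_pow, integral_const_mul, inv_pow, sq_sqrt hpos.le]
  exact inv_mul_cancel₀ hpos.ne'

section Modes

variable {h a : ℝ}

lemma isMode_cosh (ha : a * sinh (a * (π / 2)) = -h * cosh (a * (π / 2))) :
    IsMode h (-a ^ 2) (fun x => cosh (a * x)) := by
  have d1 : deriv (fun x => cosh (a * x)) = fun x => a * sinh (a * x) := by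
    ext x
    have := ((hasDerivAt_id x).const_mul a).cosh.deriv
    simp only [id] at this; rw [this]; ring
  have d2 : deriv (fun x => a * sinh (a * x)) = fun x => a ^ 2 * cosh (a * x) := by
    ext x
    have := (((hasDerivAt_id x).const_mul a).sinh.const_mul a).deriv
    simp only [id] at this; rw [this]; ring
  refine ⟨contDiff_cosh.comp (contDiff_const.mul contDiff_id), fun x => by rw [d1, d2]; ring, ?_, ?_⟩
  · rw [d1]; simp only; linarith
  · rw [d1]; simp only [mul_neg, sinh_neg, cosh_neg]; linarith

lemma isMode_sinh (ha : a * cosh (a * (π / 2)) = -h * sinh (a * (π / 2))) :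
    IsMode h (-a ^ 2) (fun x => sinh (a * x)) := by
  have d1 : deriv (fun x => sinh (a * x)) = fun x => a * cosh (a * x) := by
    ext x
    have := ((hasDerivAt_id x).const_mul a).sinh.deriv
    simp only [id] at this; rw [this]; ring
  have d2 : deriv (fun x => a * cosh (a * x)) = fun x => a ^ 2 * sinh (a * x) := by
    ext x
    have := (((hasDerivAt_id x).const_mul a).cosh.const_mul a).deriv
    simp only [id] at this; rw [this]; ring
  refine ⟨contDiff_sinh.comp (contDiff_const.mul contDiff_id), fun x => by rw [d1, d2]; ring, ?_, ?_⟩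
  · rw [d1]; simp only; linarith
  · rw [d1]; simp only [mul_neg, sinh_neg, cosh_neg]; linarith

lemma isMode_cos (ha : a * sin (a * (π / 2)) = h * cos (a * (π / 2))) :
    IsMode h (a ^ 2) (fun x => cos (a * x)) := by
  have d1 : deriv (fun x => cos (a * x)) = fun x => -(a * sin (a * x)) := by
    ext x
    have := ((hasDerivAt_id x).const_mul a).cos.deriv
    simp only [id] at this; rw [this]; ring
  have d2 : deriv (fun x => -(a * sin (a * x))) = fun x => -(a ^ 2 * cos (a * x)) := by
    ext x
    have := (((hasDerivAt_id x).const_mul a).sin.const_mul a).neg.deriv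
    simp only [id] at this; exact this.trans (by ring)
  refine ⟨contDiff_cos.comp (contDiff_const.mul contDiff_id), fun x => by rw [d1, d2], ?_, ?_⟩
  · rw [d1]; simp only; linarith
  · rw [d1]; simp only [mul_neg, sin_neg, cos_neg]; linarith

lemma isMode_sin (ha : a * cos (a * (π / 2)) = -h * sin (a * (π / 2))) :
    IsMode h (a ^ 2) (fun x => sin (a * x)) := by
  have d1 : deriv (fun x => sin (a * x)) = fun x => a * cos (a * x) := by
    ext x
    have := ((hasDerivAt_id x).const_mul a).sin.deriv
    simp only [id] at this; rw [this]; ring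
  have d2 : deriv (fun x => a * cos (a * x)) = fun x => -(a ^ 2 * sin (a * x)) := by
    ext x
    have := (((hasDerivAt_id x).const_mul a).cos.const_mul a).deriv
    simp only [id] at this; rw [this]; ring
  refine ⟨contDiff_sin.comp (contDiff_const.mul contDiff_id), fun x => by rw [d1, d2], ?_, ?_⟩
  · rw [d1]; simp only; linarith
  · rw [d1]; simp only [mul_neg, sin_neg, cos_neg]; linarith

lemma isMode_id (hh : -h * (π / 2) = 1) : IsMode h 0 (fun x => x) := by
  refine ⟨contDiff_id, fun x => by simp, ?_, ?_⟩ <;> simp <;> linarith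

end Modes

/-- The lowest even frequency: `y tanh y = K` with `y = aπ/2`, `K = -hπ/2`. -/
lemma exists_cosh_root {h : ℝ} (hh : h < 0) : ∃ a > 0,
    a * sinh (a * (π / 2)) = -h * cosh (a * (π / 2)) ∧
    -h * (π / 2) < a * (π / 2) ∧ a * (π / 2) ≤ -h * (π / 2) + 1 / 3 := by
  have hp := pi_gt_three
  set F : ℝ → ℝ := fun a => a * sinh (a * (π / 2)) - -h * cosh (a * (π / 2)) with hF
  have hFc : Continuous F := by simp only [hF]; fun_prop
  have h0 : F 0 < 0 := by simp [hF, hh]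
  -- At `a = -h + 1` the function equals `sinh y - (-h) exp(-y)` with `y = aπ/2`, and `sinh y ≥ y ≥
  -- -h`.
  have h1 : 0 ≤ F (-h + 1) := by
    have s1 := (self_le_sinh_iff (x := (-h + 1) * (π / 2))).2 (by nlinarith)
    have s2 := cosh_sub_sinh ((-h + 1) * (π / 2))
    have s3 : exp (-((-h + 1) * (π / 2))) ≤ 1 := exp_le_one_iff.2 (by nlinarith)
    simp only [hF]
    nlinarith
  obtain ⟨a, ha, ha0⟩ := intermediate_value_Icc (by linarith) hFc.continuousOn
    (show (0 : ℝ) ∈ Icc _ _ from ⟨h0.le, h1⟩)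
  have hapos : 0 < a := ha.1.lt_of_ne (by rintro rfl; linarith)
  simp only [hF, sub_eq_zero] at ha0
  refine ⟨a, hapos, ha0, ?_, ?_⟩
  · have := sinh_lt_cosh (a * (π / 2))
    have h3 := cosh_pos (a * (π / 2))
    have : -h < a := by
      by_contra hc
      nlinarith
    nlinarith
  · set y := a * (π / 2) with hy
    have hy0 : 0 < y := by positivity
    have hK : y * sinh y = -h * (π / 2) * cosh y := by
      rw [hy] at *; linear_combination (π / 2) * ha0
    have e1 := quadratic_le_exp_of_nonneg (x := 2 * y) (by positivity)
    have e2 : exp (2 * y) = exp y * exp y := by rw [← exp_add]; ring_nf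
    have e3 : exp y * exp (-y) = 1 := by rw [← exp_add]; simp
    rw [sinh_eq, cosh_eq] at hK
    set E := exp y
    set E' := exp (-y)
    have hE : 0 < E := exp_pos y
    set K := -h * (π / 2)
    have hK2 : (y - K) * (exp (2 * y) + 1) = 2 * y := by
      rw [e2]
      linear_combination 2 * E * hK + (K + y) * e3
    -- Since `exp(2y) ≥ 1 + 2y + 2y²`, the constant 1/3 reduces the claim to `(y - 1)² ≥ 0`.
    have : (y - K) * (exp (2 * y) + 1) ≤ 1 / 3 * (exp (2 * y) + 1) := by
      rw [hK2]; nlinarith [sq_nonneg (y - 1)]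
    have := le_of_mul_le_mul_right this (by positivity)
    linarith

/-- The second even frequency: `-s tan s = K` with `s = bπ/2` between `π/2` and `π`. -/
lemma exists_cos_root {h : ℝ} (hh : h < 0) : ∃ b, 1 < b ∧ b < 2 ∧
    b * sin (b * (π / 2)) = h * cos (b * (π / 2)) ∧
    (-h * (π / 2) < 1 → 7.5 ≤ (b * (π / 2)) ^ 2) := by
  have hp := pi_gt_three
  set F : ℝ → ℝ := fun b => b * sin (b * (π / 2)) - h * cos (b * (π / 2)) with hF
  have hFc : Continuous F := by simp only [hF]; fun_prop
  have h1 : 0 < F 1 := by simp [hF]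
  have h2 : F 2 < 0 := by
    have : 2 * (π / 2) = π := by ring
    simp [hF, this, hh]
  obtain ⟨b, hb, hb0⟩ := intermediate_value_Icc' (by norm_num) hFc.continuousOn
    (show (0 : ℝ) ∈ Icc _ _ from ⟨h2.le, h1.le⟩)
  have hb1 : 1 < b := hb.1.lt_of_ne (by rintro rfl; linarith)
  have hb2 : b < 2 := hb.2.lt_of_ne (by rintro rfl; linarith)
  simp only [hF, sub_eq_zero] at hb0
  refine ⟨b, hb1, hb2, hb0, fun hK => ?_⟩
  set σ := π - b * (π / 2) with hσ
  have hσ0 : 0 < σ := by rw [hσ]; nlinarith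
  have hσ1 : σ < π / 2 := by rw [hσ]; nlinarith
  have hb3 : b * (π / 2) = π - σ := by rw [hσ]; ring
  have hcos : 0 < cos σ := cos_pos_of_mem_Ioo ⟨by linarith, hσ1⟩
  have htan := le_tan hσ0.le hσ1
  rw [tan_eq_sin_div_cos, le_div_iff₀ hcos] at htan
  rw [hb3, sin_pi_sub, cos_pi_sub] at hb0
  have hK2 : (π - σ) * sin σ = -h * (π / 2) * cos σ := by
    rw [← hb3]; linear_combination (π / 2) * hb0
  -- The equation reads `(π - σ) tan σ = K < 1`, and `σ ≤ tan σ`. As `σ < π/2`, this excludes `σ ≥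
  -- 0.64`; then `π - σ > 2.5` improves the bound to `σ < 0.4`, and `2.74² > 7.5`.
  have h5 : (π - σ) * σ < 1 := by
    by_contra hc
    push Not at hc
    nlinarith [mul_le_mul_of_nonneg_left htan (show 0 ≤ π - σ by linarith)]
  have hp' := pi_gt_d2
  rw [hb3]
  have h6 : σ < 0.64 := by
    by_contra hc
    push Not at hc
    nlinarith
  have h7 : σ < 0.4 := by nlinarith
  nlinarith

/-- The lowest odd mode. -/
lemma exists_odd_mode {h : ℝ} (hh : h < 0) : ∃ (μ : ℝ) (e : ℝ → ℝ), IsMode h μ e ∧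
    (∀ x, e (-x) = -e x) ∧ (∀ x ∈ Ioc 0 (π / 2), 0 < e x) ∧
    ((-h * (π / 2) < 1 ∧ 0 < μ ∧ μ < 1) ∨ (-h * (π / 2) = 1 ∧ μ = 0) ∨
      ∃ t, 0 < t ∧ t < -h * (π / 2) ∧ μ * (π / 2) ^ 2 = -t ^ 2 ∧
        -h * (π / 2) ≤ t + 1 / (1 + t)) := by
  have hp := pi_gt_three
  have hc : 0 < π / 2 := by positivity
  rcases lt_trichotomy (-h * (π / 2)) 1 with hK | hK | hK
  · set F : ℝ → ℝ := fun d => d * cos (d * (π / 2)) - -h * sin (d * (π / 2)) with hF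
    have hFc : Continuous F := by simp only [hF]; fun_prop
    set K := -h * (π / 2) with hKdef
    have hK0 : 0 < K := mul_pos (by linarith) hc
    -- Any value of `cos r` strictly between `K` and 1 would do: `sin r ≤ r` then makes `F` positive
    -- at `d = r/(π/2)`. A positive left endpoint keeps the root away from the trivial one at 0.
    set r := arccos ((1 + K) / 2) with hr
    have hr0 : 0 < r := arccos_pos.2 (by linarith)
    have hr1 : r < π / 2 := arccos_lt_pi_div_two.2 (by linarith)
    have hcr : cos r = (1 + K) / 2 := cos_arccos (by linarith) (by linarith)
    have hd0 : 0 < r / (π / 2) := by positivity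
    have hd1 : r / (π / 2) < 1 := (div_lt_one hc).2 hr1
    have h1 : 0 < F (r / (π / 2)) := by
      have h2 := sin_le hr0.le
      simp only [hF, div_mul_cancel₀ _ hc.ne', hcr]
      have h3 : -h * sin r ≤ -h * r := mul_le_mul_of_nonneg_left h2 (by linarith)
      have h4 : -h * r = K * (r / (π / 2)) := by rw [hKdef]; field_simp
      nlinarith
    have h2 : F 1 < 0 := by simp [hF, hh]
    obtain ⟨d, hd, hd0'⟩ := intermediate_value_Icc' hd1.le
      hFc.continuousOn
      (show (0 : ℝ) ∈ Icc _ _ from ⟨h2.le, h1.le⟩)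
    have hdpos : 0 < d := hd0.trans_le hd.1
    have hdlt : d < 1 := hd.2.lt_of_ne (by rintro rfl; linarith)
    simp only [hF, sub_eq_zero] at hd0'
    refine ⟨d ^ 2, _, isMode_sin hd0', fun x => by simp, fun x hx => ?_,
      Or.inl ⟨hK, by positivity, ?_⟩⟩
    · exact sin_pos_of_pos_of_lt_pi (mul_pos hdpos hx.1) (by nlinarith [hx.1, hx.2])
    · nlinarith
  · exact ⟨0, _, isMode_id hK, fun x => rfl, fun x hx => hx.1, Or.inr (Or.inl ⟨hK, rfl⟩)⟩
  · set F : ℝ → ℝ := fun d => d * cosh (d * (π / 2)) - -h * sinh (d * (π / 2)) with hF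
    have hFc : Continuous F := by simp only [hF]; fun_prop
    set K := -h * (π / 2) with hKdef
    have hK0 : 0 < K := by linarith
    -- At this point `cosh r = (K + 1/K)/2 < K`, and `r ≤ sinh r` makes `F` negative at `r/(π/2)`,
    -- so the root found is not the trivial one at 0.
    set r := log K with hr
    have hr0 : 0 < r := log_pos hK
    have hr1 : r < K := (log_le_sub_one_of_pos hK0).trans_lt (by linarith)
    have hcr : cosh r = (K + K⁻¹) / 2 := cosh_log hK0
    have hinv : K⁻¹ < 1 := inv_lt_one_of_one_lt₀ hK
    have hd0 : 0 < r / (π / 2) := by positivity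
    have hd1 : r / (π / 2) < -h := by rw [div_lt_iff₀ hc]; exact hr1
    have h1 : F (r / (π / 2)) < 0 := by
      have h2 := self_le_sinh_iff.2 hr0.le
      simp only [hF, div_mul_cancel₀ _ hc.ne', hcr]
      have h3 : -h * r ≤ -h * sinh r := mul_le_mul_of_nonneg_left h2 (by linarith)
      have h4 : -h * r = K * (r / (π / 2)) := by rw [hKdef]; field_simp
      nlinarith
    have h2 : 0 < F (-h) := by
      simp only [hF]
      nlinarith [sinh_lt_cosh (-h * (π / 2))]
    obtain ⟨d, hd, hd0'⟩ := intermediate_value_Icc hd1.le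
      hFc.continuousOn
      (show (0 : ℝ) ∈ Icc _ _ from ⟨h1.le, h2.le⟩)
    have hdpos : 0 < d := hd0.trans_le hd.1
    have hdlt : d < -h := hd.2.lt_of_ne (by rintro rfl; linarith)
    simp only [hF, sub_eq_zero] at hd0'
    refine ⟨-d ^ 2, _, isMode_sinh hd0', fun x => by simp, fun x hx => ?_,
      Or.inr (Or.inr ⟨d * (π / 2), by positivity, by nlinarith, by ring, ?_⟩)⟩
    · exact sinh_pos_iff.2 (mul_pos hdpos hx.1)
    · set t := d * (π / 2) with ht
      have ht0 : 0 < t := by positivity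
      have hKt : t * cosh t = K * sinh t := by
        rw [hKdef, ht] at *; linear_combination (π / 2) * hd0'
      have e1 := quadratic_le_exp_of_nonneg (x := 2 * t) (by positivity)
      have e2 : exp (2 * t) = exp t * exp t := by rw [← exp_add]; ring_nf
      have e3 : exp t * exp (-t) = 1 := by rw [← exp_add]; simp
      rw [sinh_eq, cosh_eq] at hKt
      set E := exp t
      set E' := exp (-t)
      have hK2 : (K - t) * (exp (2 * t) - 1) = 2 * t := by
        rw [e2]
        linear_combination -2 * E * hKt + (K + t) * e3
      -- From `exp(2t) - 1 ≥ 2t + 2t² = 2t(1 + t)`.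
      have hK3 : (K - t) * (exp (2 * t) - 1) ≤ 1 / (1 + t) * (exp (2 * t) - 1) := by
        rw [hK2, div_mul_eq_mul_div, le_div_iff₀ (by positivity)]
        nlinarith
      have := le_of_mul_le_mul_right hK3 (by nlinarith)
      linarith

/-- The derivative has the sign of `-(b sin(bx) cosh(ax) + a cos(bx) sinh(ax))`. Only `cos(bx) < 0`
is delicate; there the Robin conditions at `π/2` give `b sin(bx) > h cos(bx)` and `a sinh(ax) < -h
cosh(ax)`, whose combination settles the sign. -/
lemma strictAntiOn_cos_div_cosh {h a b : ℝ} (ha : 0 < a) (hb : 1 < b) (hb2 : b < 2)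
    (ha0 : a * sinh (a * (π / 2)) = -h * cosh (a * (π / 2)))
    (hb0 : b * sin (b * (π / 2)) = h * cos (b * (π / 2))) :
    StrictAntiOn (fun x => cos (b * x) / cosh (a * x)) (Icc 0 (π / 2)) := by
  have hp := pi_gt_three
  have hcosc : cos (b * (π / 2)) < 0 :=
    cos_neg_of_pi_div_two_lt_of_lt (by nlinarith) (by nlinarith)
  refine strictAntiOn_of_deriv_neg (convex_Icc _ _) ?_ fun x hx => ?_
  · exact Continuous.continuousOn (by
      refine Continuous.div (by fun_prop) (by fun_prop) fun x => (cosh_pos _).ne')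
  · rw [interior_Icc] at hx
    have hC := cosh_pos (a * x)
    have hS : 0 < sinh (a * x) := sinh_pos_iff.2 (mul_pos ha hx.1)
    have hd : HasDerivAt (fun x => cos (b * x) / cosh (a * x))
        (-(b * sin (b * x) * cosh (a * x) + a * cos (b * x) * sinh (a * x)) / cosh (a * x) ^ 2)
        x := by
      have d1 := ((hasDerivAt_id x).const_mul b).cos
      have d2 := ((hasDerivAt_id x).const_mul a).cosh
      refine (d1.div d2 hC.ne').congr_deriv ?_
      simp only [id]; ring
    rw [hd.deriv]
    refine div_neg_of_neg_of_pos (neg_neg_of_pos ?_) (by positivity)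
    have hsin : 0 < sin (b * x) :=
      sin_pos_of_pos_of_lt_pi (mul_pos (by linarith) hx.1) (by nlinarith [hx.1, hx.2])
    rcases le_or_gt 0 (cos (b * x)) with hcos | hcos
    · positivity
    -- The addition formulas, with the boundary conditions substituted at `π/2`, turn these two
    -- positivity facts into `k1` and `k2`.
    · have s1 : 0 < sin (b * (π / 2) - b * x) :=
        sin_pos_of_pos_of_lt_pi (by nlinarith [hx.2]) (by nlinarith [hx.1])
      have s2 : 0 < sinh (a * (π / 2) - a * x) := sinh_pos_iff.2 (by nlinarith [hx.2])
      rw [sin_sub] at s1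
      rw [sinh_sub] at s2
      have k1 : 0 < -h * cos (b * x) + b * sin (b * x) := by
        have : 0 < -cos (b * (π / 2)) * (-h * cos (b * x) + b * sin (b * x)) := by
          have := mul_pos (show 0 < b by linarith) s1
          linear_combination this + cos (b * x) * hb0
        exact (mul_pos_iff_of_pos_left (by linarith)).1 this
      have k2 : 0 < -h * cosh (a * x) - a * sinh (a * x) := by
        have : 0 < cosh (a * (π / 2)) * (-h * cosh (a * x) - a * sinh (a * x)) := by
          have := mul_pos ha s2
          linear_combination this + cosh (a * x) * ha0
        exact (mul_pos_iff_of_pos_left (cosh_pos _)).1 this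
      nlinarith [mul_pos hC k1, mul_pos (neg_pos.2 hcos) k2]

/-- The hard part is the inequality `2μ₁ ≤ μ₀ + μ₂`, checked after multiplication by `(π/2)²`
separately for `K < 1`, `K = 1` and `K > 1`. The condition `centre` follows from `cosh(aπ/2) > 1 ≥
-cos(bπ/2)`. -/
theorem exists_modeTriple {h : ℝ} (hh : h < 0) :
    ∃ (μ₀ μ₁ μ₂ : ℝ) (e₀ e₁ e₂ : ℝ → ℝ), ModeTriple h μ₀ μ₁ μ₂ e₀ e₁ e₂ := by
  have hp := pi_gt_d2
  have hp' := pi_lt_d2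
  obtain ⟨a, ha, ha0, hKy, hyK⟩ := exists_cosh_root hh
  obtain ⟨b, hb1, hb2, hb0, hbK⟩ := exists_cos_root hh
  obtain ⟨μ, e, he, hodd, hpos, hμ⟩ := exists_odd_mode hh
  have hmem : π / 2 ∈ Icc (-(π / 2)) (π / 2) := ⟨by linarith, le_rfl⟩
  have hcosc : cos (b * (π / 2)) < 0 :=
    cos_neg_of_pi_div_two_lt_of_lt (by nlinarith) (by nlinarith)
  have hmem' : π / 2 ∈ Ioc 0 (π / 2) := ⟨by linarith, le_rfl⟩
  obtain ⟨c₀, hc₀, hn₀⟩ := exists_normalization (isMode_cosh ha0).continuous hmem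
    (cosh_pos _).ne'
  obtain ⟨c₁, hc₁, hn₁⟩ := exists_normalization he.continuous hmem (hpos _ hmem').ne'
  obtain ⟨c₂, hc₂, hn₂⟩ := exists_normalization (isMode_cos hb0).continuous hmem hcosc.ne
  have hratio : ∀ x, c₂ * cos (b * x) / (c₀ * cosh (a * x))
      = c₂ / c₀ * (cos (b * x) / cosh (a * x)) := fun x => mul_div_mul_comm _ _ _ _
  have hc : 0 < c₂ / c₀ := by positivity
  have hsq : 0 < (π / 2) ^ 2 := by positivity
  set K := -h * (π / 2)
  have hK0 : 0 < K := mul_pos (by linarith) (by positivity)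
  have hgap : -a ^ 2 < μ ∧ 2 * μ ≤ -a ^ 2 + b ^ 2 := by
    rcases hμ with ⟨hK, h0, h1⟩ | ⟨hK, rfl⟩ | ⟨t, ht, htK, hμt, htK'⟩
    -- Here `2(3.15/2)² + (4/3)² < 7.5`. For `K` close to 1 the crude bound `b > 1` would not be
    -- enough.
    · have hs := hbK hK
      refine ⟨by nlinarith, ?_⟩
      refine le_of_mul_le_mul_right ?_ hsq
      have h3 : (a * (π / 2)) ^ 2 ≤ (4 / 3) ^ 2 := by gcongr; linarith
      have h4 : μ * (π / 2) ^ 2 ≤ (3.15 / 2) ^ 2 := by nlinarith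
      nlinarith
    · refine ⟨by nlinarith, ?_⟩
      refine le_of_mul_le_mul_right ?_ hsq
      have h3 : (a * (π / 2)) ^ 2 ≤ (4 / 3) ^ 2 := by gcongr; linarith
      have h4 : (3.14 / 2) ^ 2 ≤ (b * (π / 2)) ^ 2 := by gcongr; nlinarith
      nlinarith
    · constructor
      · refine lt_of_mul_lt_mul_right ?_ hsq.le
        have : t ^ 2 < (a * (π / 2)) ^ 2 := by gcongr; linarith
        nlinarith
      · refine le_of_mul_le_mul_right ?_ hsq
        have h4 : (3.14 / 2) ^ 2 ≤ (b * (π / 2)) ^ 2 := by gcongr; nlinarith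
        have h3 : (a * (π / 2)) ^ 2 ≤ (t + 1 / (1 + t) + 1 / 3) ^ 2 := by gcongr; linarith
        -- Since `tw = 1 - w` and `w² ≤ w`, the square `(t + w + 1/3)²` is at most `t² + 2t/3 +
        -- 19/9`. Then `2t/3 ≤ t² + 1/9` leaves `2t² + 20/9`, and `20/9 < 1.57²`.
        set w := 1 / (1 + t) with hw
        have hw0 : 0 < w := by positivity
        have hw1 : w ≤ 1 := by rw [hw, div_le_one (by positivity)]; linarith
        have htw : t * w = 1 - w := by rw [hw]; field_simp; ring
        have hsum : (t + w + 1 / 3) ^ 2 = t ^ 2 + 2 / 3 * t + 19 / 9 + w ^ 2 - 4 / 3 * w := by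
          linear_combination 2 * htw
        have hw2 : w ^ 2 ≤ w := by nlinarith
        have ht2 := sq_nonneg (t - 1 / 3)
        have e1 : 2 * μ * (π / 2) ^ 2 = -2 * t ^ 2 := by linear_combination 2 * hμt
        have e2 : (-a ^ 2 + b ^ 2) * (π / 2) ^ 2 = (b * (π / 2)) ^ 2 - (a * (π / 2)) ^ 2 := by ring
        rw [e1, e2]
        linarith
  have hanti := strictAntiOn_cos_div_cosh ha hb1 hb2 ha0 hb0
  refine ⟨-a ^ 2, μ, b ^ 2, _, _, _, (isMode_cosh ha0).const_mul c₀, he.const_mul c₁,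
    (isMode_cos hb0).const_mul c₂, hgap.1, hgap.2, hn₀, hn₁, hn₂, fun x => by simp,
    fun x => by simp [hodd], fun x => by simp, fun x => mul_pos hc₀ (cosh_pos _),
    fun x hx => mul_pos hc₁ (hpos x hx), fun x hx => ?_, ?_, ?_, ?_⟩
  · have hd : HasDerivAt (fun x => c₂ * cos (b * x)) (c₂ * -(b * sin (b * x))) x := by
      refine (((hasDerivAt_id x).const_mul b).cos.const_mul c₂).congr_deriv ?_
      simp only [id]; ring
    rw [hd.deriv]
    have hcos : cos (b * x) = 0 := by simpa [hc₂.ne'] using hx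
    have hsin : sin (b * x) ≠ 0 := fun h0 => by
      have := sin_sq_add_cos_sq (b * x)
      rw [h0, hcos] at this; norm_num at this
    have : b ≠ 0 := by linarith
    simp [*, hc₂.ne']
  · simp only [hratio]
    exact fun x hx y hy hxy => mul_lt_mul_of_pos_left (hanti hx hy hxy) hc
  · rw [hratio]
    exact mul_neg_of_pos_of_neg hc (div_neg_of_neg_of_pos hcosc (cosh_pos _))
  · rw [hratio, hratio, ← mul_add]
    refine mul_pos hc ?_
    have h1 : 1 < cosh (a * (π / 2)) := one_lt_cosh.2 (by positivity)
    have h2 := neg_one_le_cos (b * (π / 2))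
    have h3 : -1 < cos (b * (π / 2)) / cosh (a * (π / 2)) := by
      rw [lt_div_iff₀ (by positivity)]; linarith
    simp only [mul_zero, cos_zero, cosh_zero]
    linarith


/-! ### Integrals and partial derivatives on the square -/

lemma area_eq_prod : area = edge.prod edge := by
  rw [area, square, edge, Measure.prod_restrict, Measure.volume_eq_prod]

instance : IsFiniteMeasure area := by
  rw [area_eq_prod]; infer_instance

section Continuous

variable {F G : ℝ × ℝ → ℝ}

lemma integrable_area (hF : Continuous F) : Integrable F area :=
  (hF.continuousOn.integrableOn_compact
    (isCompact_Icc.prod isCompact_Icc : IsCompact (Icc (-(π / 2)) (π / 2) ×ˢ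
      Icc (-(π / 2)) (π / 2)))).mono_set
    (prod_mono Ioo_subset_Icc_self Ioo_subset_Icc_self)

lemma memLp_area (hF : Continuous F) : MemLp F 2 area :=
  (memLp_two_iff_integrable_sq hF.aestronglyMeasurable).2 (integrable_area (by fun_prop))

lemma integral_area (hF : Continuous F) :
    ∫ p, F p ∂area = ∫ y, ∫ x, F (x, y) ∂edge ∂edge := by
  rw [area_eq_prod, integral_prod_symm _ (area_eq_prod ▸ integrable_area hF)]

lemma integral_area' (hF : Continuous F) :
    ∫ p, F p ∂area = ∫ x, ∫ y, F (x, y) ∂edge ∂edge := by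
  rw [area_eq_prod, integral_prod _ (area_eq_prod ▸ integrable_area hF)]

lemma continuous_integral_fst (hF : Continuous F) :
    Continuous fun y => ∫ x, F (x, y) ∂edge := by
  simp only [integral_edge]
  exact intervalIntegral.continuous_parametric_intervalIntegral_of_continuous'
    (by unfold Function.uncurry; fun_prop) _ _

lemma continuous_integral_snd (hF : Continuous F) :
    Continuous fun x => ∫ y, F (x, y) ∂edge := by
  simp only [integral_edge]
  exact intervalIntegral.continuous_parametric_intervalIntegral_of_continuous'
    (by unfold Function.uncurry; fun_prop) _ _

lemma arcLength_eq : arcLength = edge.map (fun y => (-(π / 2), y)) +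
    edge.map (fun y => (π / 2, y)) + edge.map (fun x => (x, -(π / 2))) +
    edge.map (fun x => (x, π / 2)) := by
  have : edge = volume.restrict (Icc (-(π / 2)) (π / 2)) :=
    Measure.restrict_congr_set Ioo_ae_eq_Icc
  rw [this]; rfl

lemma integrable_map_edge (hF : Continuous F) {j : ℝ → ℝ × ℝ} (hj : Continuous j) :
    Integrable F (edge.map j) :=
  (integrable_map_measure hF.aestronglyMeasurable hj.aemeasurable).2
    (integrable_edge (hF.comp hj))

lemma integrable_arcLength (hF : Continuous F) : Integrable F arcLength := by
  rw [arcLength_eq]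
  exact (((integrable_map_edge hF (by fun_prop)).add_measure
    (integrable_map_edge hF (by fun_prop))).add_measure
    (integrable_map_edge hF (by fun_prop))).add_measure (integrable_map_edge hF (by fun_prop))

lemma memLp_arcLength (hF : Continuous F) : MemLp F 2 arcLength :=
  (memLp_two_iff_integrable_sq hF.aestronglyMeasurable).2 (integrable_arcLength (by fun_prop))

lemma integral_arcLength (hF : Continuous F) :
    ∫ p, F p ∂arcLength = ∫ y, (F (π / 2, y) + F (-(π / 2), y)) ∂edge +
      ∫ x, (F (x, π / 2) + F (x, -(π / 2))) ∂edge := by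
  have hi : ∀ {j : ℝ → ℝ × ℝ}, Continuous j → Integrable F (edge.map j) :=
    fun hj => integrable_map_edge hF hj
  have hm : ∀ {j : ℝ → ℝ × ℝ}, Continuous j → ∫ p, F p ∂(edge.map j) = ∫ x, F (j x) ∂edge :=
    fun hj => integral_map hj.aemeasurable hF.aestronglyMeasurable
  rw [arcLength_eq, integral_add_measure ((((hi (by fun_prop)).add_measure
    (hi (by fun_prop)))).add_measure (hi (by fun_prop))) (hi (by fun_prop)),
    integral_add_measure ((hi (by fun_prop)).add_measure (hi (by fun_prop))) (hi (by fun_prop)),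
    integral_add_measure (hi (by fun_prop)) (hi (by fun_prop)),
    hm (by fun_prop), hm (by fun_prop), hm (by fun_prop), hm (by fun_prop),
    integral_add (integrable_edge (by fun_prop)) (integrable_edge (by fun_prop)),
    integral_add (integrable_edge (by fun_prop)) (integrable_edge (by fun_prop))]
  ring

end Continuous

section Derivatives

variable {φ ψ : ℝ × ℝ → ℝ}

lemma hasDerivAt_fst (hφ : ContDiff ℝ ∞ φ) (x y : ℝ) :
    HasDerivAt (fun x => φ (x, y)) (dx φ (x, y)) x :=
  (hφ.differentiable (by simp) (x, y)).hasFDerivAt.comp_hasDerivAt x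
    ((hasDerivAt_id x).prodMk (hasDerivAt_const x y))

lemma hasDerivAt_snd (hφ : ContDiff ℝ ∞ φ) (x y : ℝ) :
    HasDerivAt (fun y => φ (x, y)) (dy φ (x, y)) y :=
  (hφ.differentiable (by simp) (x, y)).hasFDerivAt.comp_hasDerivAt y
    ((hasDerivAt_const y x).prodMk (hasDerivAt_id y))

lemma continuous_dx (hφ : ContDiff ℝ ∞ φ) : Continuous (dx φ) :=
  (hφ.continuous_fderiv (by simp)).clm_apply continuous_const

lemma continuous_dy (hφ : ContDiff ℝ ∞ φ) : Continuous (dy φ) :=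
  (hφ.continuous_fderiv (by simp)).clm_apply continuous_const

lemma dx_add (hφ : ContDiff ℝ ∞ φ) (hψ : ContDiff ℝ ∞ ψ) (p : ℝ × ℝ) :
    dx (fun p => φ p + ψ p) p = dx φ p + dx ψ p := by
  unfold dx
  rw [fderiv_fun_add (hφ.differentiable (by simp) p) (hψ.differentiable (by simp) p)]
  rfl

lemma dy_add (hφ : ContDiff ℝ ∞ φ) (hψ : ContDiff ℝ ∞ ψ) (p : ℝ × ℝ) :
    dy (fun p => φ p + ψ p) p = dy φ p + dy ψ p := by
  unfold dy
  rw [fderiv_fun_add (hφ.differentiable (by simp) p) (hψ.differentiable (by simp) p)]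
  rfl

lemma contDiff_tensor {e k : ℝ → ℝ} (he : ContDiff ℝ ∞ e) (hk : ContDiff ℝ ∞ k) :
    ContDiff ℝ ∞ (fun p : ℝ × ℝ => e p.1 * k p.2) :=
  (he.comp contDiff_fst).mul (hk.comp contDiff_snd)

lemma dx_tensor {e k : ℝ → ℝ} (he : ContDiff ℝ ∞ e) (hk : ContDiff ℝ ∞ k) (p : ℝ × ℝ) :
    dx (fun p : ℝ × ℝ => e p.1 * k p.2) p = deriv e p.1 * k p.2 :=
  (hasDerivAt_fst (contDiff_tensor he hk) p.1 p.2).unique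
    ((he.differentiable (by simp) p.1).hasDerivAt.mul_const (k p.2))

lemma dy_tensor {e k : ℝ → ℝ} (he : ContDiff ℝ ∞ e) (hk : ContDiff ℝ ∞ k) (p : ℝ × ℝ) :
    dy (fun p : ℝ × ℝ => e p.1 * k p.2) p = e p.1 * deriv k p.2 :=
  (hasDerivAt_snd (contDiff_tensor he hk) p.1 p.2).unique
    ((hk.differentiable (by simp) p.2).hasDerivAt.const_mul (e p.1))

end Derivatives

/-! ### Smooth solutions by separation of variables -/

/-- A smooth function that satisfies the weak Robin eigenvalue equation against smooth functions. -/
structure IsSmoothMode (h μ : ℝ) (v : ℝ × ℝ → ℝ) : Prop where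
  contDiff : ContDiff ℝ ∞ v
  weak : ∀ φ : ℝ × ℝ → ℝ, ContDiff ℝ ∞ φ →
    ∫ p, (dx v p * dx φ p + dy v p * dy φ p) ∂area + h * ∫ p, v p * φ p ∂arcLength =
      μ * ∫ p, v p * φ p ∂area

lemma IsSmoothMode.add {h μ : ℝ} {v w : ℝ × ℝ → ℝ} (hv : IsSmoothMode h μ v)
    (hw : IsSmoothMode h μ w) : IsSmoothMode h μ (fun p => v p + w p) := by
  refine ⟨hv.contDiff.add hw.contDiff, fun φ hφ => ?_⟩
  have c1 := continuous_dx hv.contDiff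
  have c2 := continuous_dy hv.contDiff
  have c3 := continuous_dx hw.contDiff
  have c4 := continuous_dy hw.contDiff
  have c5 := continuous_dx hφ
  have c6 := continuous_dy hφ
  have c7 := hv.contDiff.continuous
  have c8 := hw.contDiff.continuous
  have c9 := hφ.continuous
  have e1 : ∫ p, (dx (fun p => v p + w p) p * dx φ p + dy (fun p => v p + w p) p * dy φ p) ∂area
      = ∫ p, (dx v p * dx φ p + dy v p * dy φ p) ∂area
        + ∫ p, (dx w p * dx φ p + dy w p * dy φ p) ∂area := by
    rw [← integral_add (integrable_area (by fun_prop)) (integrable_area (by fun_prop))]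
    congr 1; ext p
    rw [dx_add hv.contDiff hw.contDiff, dy_add hv.contDiff hw.contDiff]; ring
  have e2 : ∫ p, (v p + w p) * φ p ∂area = ∫ p, v p * φ p ∂area + ∫ p, w p * φ p ∂area := by
    rw [← integral_add (integrable_area (by fun_prop)) (integrable_area (by fun_prop))]
    congr 1; ext p; ring
  have e3 : ∫ p, (v p + w p) * φ p ∂arcLength
      = ∫ p, v p * φ p ∂arcLength + ∫ p, w p * φ p ∂arcLength := by
    rw [← integral_add (integrable_arcLength (by fun_prop)) (integrable_arcLength (by fun_prop))]
    congr 1; ext p; ring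
  rw [e1, e2, e3]
  linear_combination hv.weak φ hφ + hw.weak φ hφ

/-- The one-dimensional weak equation is applied to `φ` on each horizontal and each vertical slice,
weighted by the other factor and integrated; the boundary terms of the two families make up the four
edges. -/
lemma IsMode.tensor {h μ ν : ℝ} {e k : ℝ → ℝ} (he : IsMode h μ e) (hk : IsMode h ν k) :
    IsSmoothMode h (μ + ν) (fun p => e p.1 * k p.2) := by
  refine ⟨contDiff_tensor he.contDiff hk.contDiff, fun φ hφ => ?_⟩
  have c1 := he.continuous
  have c2 := hk.continuous
  have c3 := he.contDiff_deriv.continuous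
  have c4 := hk.contDiff_deriv.continuous
  have c5 := continuous_dx hφ
  have c6 := continuous_dy hφ
  have c7 := hφ.continuous
  simp only [dx_tensor he.contDiff hk.contDiff, dy_tensor he.contDiff hk.contDiff]
  have hx : ∀ y, k y * ∫ x, deriv e x * dx φ (x, y) ∂edge
      + h * (k y * (e (π / 2) * φ (π / 2, y) + e (-(π / 2)) * φ (-(π / 2), y)))
      = μ * (k y * ∫ x, e x * φ (x, y) ∂edge) := by
    intro y
    have := he.weak (f := fun x => φ (x, y))
      ((hφ.comp (by fun_prop : ContDiff ℝ ∞ fun x : ℝ => (x, y))).of_le (by simp))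
    simp only [(hasDerivAt_fst hφ _ y).deriv] at this
    linear_combination k y * this
  have hy : ∀ x, e x * ∫ y, deriv k y * dy φ (x, y) ∂edge
      + h * (e x * (k (π / 2) * φ (x, π / 2) + k (-(π / 2)) * φ (x, -(π / 2))))
      = ν * (e x * ∫ y, k y * φ (x, y) ∂edge) := by
    intro x
    have := hk.weak (f := fun y => φ (x, y))
      ((hφ.comp (by fun_prop : ContDiff ℝ ∞ fun y : ℝ => (x, y))).of_le (by simp))
    simp only [(hasDerivAt_snd hφ x _).deriv] at this
    linear_combination e x * this
  have f1 := continuous_integral_fst (F := fun p => deriv e p.1 * dx φ p) (by fun_prop)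
  have f2 := continuous_integral_snd (F := fun p => deriv k p.2 * dy φ p) (by fun_prop)
  have ix := congrArg (fun f : ℝ → ℝ => ∫ y, f y ∂edge) (funext hx)
  have iy := congrArg (fun f : ℝ → ℝ => ∫ y, f y ∂edge) (funext hy)
  simp only at f1 f2 ix iy
  rw [integral_add (integrable_edge (by fun_prop)) (integrable_edge (by fun_prop)),
    integral_const_mul, integral_const_mul] at ix iy
  have g1 : ∫ p, deriv e p.1 * k p.2 * dx φ p ∂area
      = ∫ y, k y * ∫ x, deriv e x * dx φ (x, y) ∂edge ∂edge := by
    rw [integral_area (by fun_prop)]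
    congr 1; ext y
    rw [← integral_const_mul]
    congr 1; ext x; ring
  have g2 : ∫ p, e p.1 * deriv k p.2 * dy φ p ∂area
      = ∫ x, e x * ∫ y, deriv k y * dy φ (x, y) ∂edge ∂edge := by
    rw [integral_area' (by fun_prop)]
    congr 1; ext y
    rw [← integral_const_mul]
    congr 1; ext x; ring
  have g3 : ∫ p, e p.1 * k p.2 * φ p ∂area = ∫ y, k y * ∫ x, e x * φ (x, y) ∂edge ∂edge := by
    rw [integral_area (by fun_prop)]
    congr 1; ext y
    rw [← integral_const_mul]
    congr 1; ext x; ring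
  have g4 : ∫ p, e p.1 * k p.2 * φ p ∂area = ∫ x, e x * ∫ y, k y * φ (x, y) ∂edge ∂edge := by
    rw [integral_area' (by fun_prop)]
    congr 1; ext y
    rw [← integral_const_mul]
    congr 1; ext x; ring
  rw [← g1, ← g3] at ix
  rw [← g2, ← g4] at iy
  rw [integral_add (integrable_area (by fun_prop)) (integrable_area (by fun_prop)),
    integral_arcLength (by fun_prop)]
  have g5 : ∀ y, e (π / 2) * k y * φ (π / 2, y) + e (-(π / 2)) * k y * φ (-(π / 2), y)
    = k y * (e (π / 2) * φ (π / 2, y) + e (-(π / 2)) * φ (-(π / 2), y)) := fun y => by ring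
  have g6 : ∀ x, e x * k (π / 2) * φ (x, π / 2) + e x * k (-(π / 2)) * φ (x, -(π / 2))
    = e x * (k (π / 2) * φ (x, π / 2) + k (-(π / 2)) * φ (x, -(π / 2))) := fun y => by ring
  simp only [g5, g6]
  linear_combination ix + iy

/-! ### Bessel inequalities and the spectral bound on the square -/

/-- Bessel's equality for an orthonormal pair on the interval. -/
lemma integral_edge_sub_proj {f p q : ℝ → ℝ} (hf : Continuous f) (hp : Continuous p)
    (hq : Continuous q) (np : ∫ x, p x ^ 2 ∂edge = 1) (nq : ∫ x, q x ^ 2 ∂edge = 1)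
    (hpq : ∫ x, p x * q x ∂edge = 0) {α β : ℝ} (hα : ∫ x, p x * f x ∂edge = α)
    (hβ : ∫ x, q x * f x ∂edge = β) :
    ∫ x, (f x - α * p x - β * q x) ^ 2 ∂edge = ∫ x, f x ^ 2 ∂edge - α ^ 2 - β ^ 2 := by
  rw [integral_edge_sq_sub hf hp hq, np, nq, hpq, hα, hβ]; ring

lemma bessel_edge {f p q : ℝ → ℝ} (hf : Continuous f) (hp : Continuous p)
    (hq : Continuous q) (np : ∫ x, p x ^ 2 ∂edge = 1) (nq : ∫ x, q x ^ 2 ∂edge = 1)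
    (hpq : ∫ x, p x * q x ∂edge = 0) {α β : ℝ} (hα : ∫ x, p x * f x ∂edge = α)
    (hβ : ∫ x, q x * f x ∂edge = β) : α ^ 2 + β ^ 2 ≤ ∫ x, f x ^ 2 ∂edge := by
  have := integral_edge_sub_proj hf hp hq np nq hpq hα hβ
  have h0 : 0 ≤ ∫ x, (f x - α * p x - β * q x) ^ 2 ∂edge :=
    integral_nonneg fun x => sq_nonneg _
  linarith

section Bessel

variable {φ : ℝ × ℝ → ℝ} {p q : ℝ → ℝ}

lemma integral_mul_integral_fst (hφ : Continuous φ) (hp : Continuous p) (hq : Continuous q) :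
    ∫ y, q y * ∫ x, p x * φ (x, y) ∂edge ∂edge = ∫ z, p z.1 * q z.2 * φ z ∂area := by
  rw [integral_area (by fun_prop)]
  congr 1; ext y
  rw [← integral_const_mul]
  congr 1; ext x; ring

lemma integral_mul_integral_snd (hφ : Continuous φ) (hp : Continuous p) (hq : Continuous q) :
    ∫ x, p x * ∫ y, q y * φ (x, y) ∂edge ∂edge = ∫ z, p z.1 * q z.2 * φ z ∂area := by
  rw [integral_area' (by fun_prop)]
  congr 1; ext y
  rw [← integral_const_mul]
  congr 1; ext x; ring

/-- A Bessel inequality on the square for the functions of the form `p(x)a(y)`, `q(x)a(y)`,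
`a(x)p(y)`, `a(x)q(y)`, where `p, q` is an orthonormal pair on the interval. -/
lemma bessel_area (hφ : Continuous φ) (hp : Continuous p) (hq : Continuous q)
    (np : ∫ x, p x ^ 2 ∂edge = 1) (nq : ∫ x, q x ^ 2 ∂edge = 1)
    (hpq : ∫ x, p x * q x ∂edge = 0) :
    ∫ y, (∫ x, p x * φ (x, y) ∂edge) ^ 2 ∂edge + ∫ y, (∫ x, q x * φ (x, y) ∂edge) ^ 2 ∂edge
      + ∫ x, (∫ y, p y * φ (x, y) ∂edge) ^ 2 ∂edge + ∫ x, (∫ y, q y * φ (x, y) ∂edge) ^ 2 ∂edge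
    ≤ ∫ z, φ z ^ 2 ∂area + (∫ z, p z.1 * p z.2 * φ z ∂area) ^ 2
      + (∫ z, p z.1 * q z.2 * φ z ∂area) ^ 2 + (∫ z, q z.1 * p z.2 * φ z ∂area) ^ 2
      + (∫ z, q z.1 * q z.2 * φ z ∂area) ^ 2 := by
  set a : ℝ → ℝ := fun y => ∫ x, p x * φ (x, y) ∂edge with ha
  set a' : ℝ → ℝ := fun y => ∫ x, q x * φ (x, y) ∂edge with ha'
  set b : ℝ → ℝ := fun x => ∫ y, p y * φ (x, y) ∂edge with hb
  set b' : ℝ → ℝ := fun x => ∫ y, q y * φ (x, y) ∂edge with hb'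
  have ca : Continuous a :=
    continuous_integral_fst (F := fun z => p z.1 * φ z) (by fun_prop)
  have ca' : Continuous a' :=
    continuous_integral_fst (F := fun z => q z.1 * φ z) (by fun_prop)
  have cb : Continuous b :=
    continuous_integral_snd (F := fun z => p z.2 * φ z) (by fun_prop)
  have cb' : Continuous b' :=
    continuous_integral_snd (F := fun z => q z.2 * φ z) (by fun_prop)
  set A := ∫ z, p z.1 * p z.2 * φ z ∂area
  set B := ∫ z, p z.1 * q z.2 * φ z ∂area
  set C := ∫ z, q z.1 * p z.2 * φ z ∂area
  set D := ∫ z, q z.1 * q z.2 * φ z ∂area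
  have npa : ∫ y, p y * a y ∂edge = A := integral_mul_integral_fst hφ hp hp
  have nqa : ∫ y, q y * a y ∂edge = B := integral_mul_integral_fst hφ hp hq
  have npa' : ∫ y, p y * a' y ∂edge = C := integral_mul_integral_fst hφ hq hp
  have nqa' : ∫ y, q y * a' y ∂edge = D := integral_mul_integral_fst hφ hq hq
  have npb : ∫ y, p y * b y ∂edge = A := integral_mul_integral_snd hφ hp hp
  have nqb : ∫ y, q y * b y ∂edge = C := integral_mul_integral_snd hφ hq hp
  have npb' : ∫ y, p y * b' y ∂edge = B := integral_mul_integral_snd hφ hp hq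
  have nqb' : ∫ y, q y * b' y ∂edge = D := integral_mul_integral_snd hφ hq hq
  -- The families in `x` and in `y` overlap in the four products, so Bessel is applied twice: `r` is
  -- `φ` minus its projection in `y`, and the horizontal slices of `r` are then tested against `p`
  -- and `q`. The overlap is the source of the four squares on the right.
  set r : ℝ × ℝ → ℝ := fun z => φ z - b z.1 * p z.2 - b' z.1 * q z.2 with hr
  have cr : Continuous r := by fun_prop
  have coef : ∀ (k : ℝ → ℝ), Continuous k → ∀ y, ∫ x, k x * r (x, y) ∂edge
      = ∫ x, k x * φ (x, y) ∂edge - (∫ x, k x * b x ∂edge) * p y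
        - (∫ x, k x * b' x ∂edge) * q y := by
    intro k hk y
    rw [← integral_mul_const, ← integral_mul_const,
      ← integral_sub (integrable_edge (by fun_prop)) (integrable_edge (by fun_prop)),
      ← integral_sub (integrable_edge (by fun_prop)) (integrable_edge (by fun_prop))]
    congr 1; ext x; simp only [hr]; ring
  have slice : ∀ y, (a y - A * p y - B * q y) ^ 2 + (a' y - C * p y - D * q y) ^ 2
      ≤ ∫ x, r (x, y) ^ 2 ∂edge := fun y =>
    bessel_edge (by fun_prop) hp hq np nq hpq (by rw [coef p hp, npb, npb'])
      (by rw [coef q hq, nqb, nqb'])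
  have cs : Continuous fun y => ∫ x, r (x, y) ^ 2 ∂edge :=
    continuous_integral_fst (F := fun z => r z ^ 2) (by fun_prop)
  have total := integral_mono (μ := edge) (integrable_edge (by fun_prop)) (integrable_edge cs)
    slice
  rw [integral_add (integrable_edge (by fun_prop)) (integrable_edge (by fun_prop)),
    integral_edge_sub_proj ca hp hq np nq hpq npa nqa,
    integral_edge_sub_proj ca' hp hq np nq hpq npa' nqa',
    ← integral_area (F := fun z => r z ^ 2) (by fun_prop), integral_area' (by fun_prop)] at total
  have slice' : ∀ x, ∫ y, r (x, y) ^ 2 ∂edge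
      = ∫ y, φ (x, y) ^ 2 ∂edge - b x ^ 2 - b' x ^ 2 := fun x =>
    integral_edge_sub_proj (by fun_prop) hp hq np nq hpq rfl rfl
  have cφ : Continuous fun x => ∫ y, φ (x, y) ^ 2 ∂edge :=
    continuous_integral_snd (F := fun z => φ z ^ 2) (by fun_prop)
  simp only [slice'] at total
  rw [integral_sub (integrable_edge (by fun_prop)) (integrable_edge (by fun_prop)),
    integral_sub (integrable_edge (by fun_prop)) (integrable_edge (by fun_prop)),
    ← integral_area' (F := fun z => φ z ^ 2) (by fun_prop)] at total
  linarith

end Bessel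

namespace ModeTriple

variable {h μ₀ μ₁ μ₂ : ℝ} {e₀ e₁ e₂ : ℝ → ℝ}

/-- The spectral lower bound for the Robin form on the square. -/
lemma lower_bound_area (H : ModeTriple h μ₀ μ₁ μ₂ e₀ e₁ e₂) {φ : ℝ × ℝ → ℝ}
    (hφ : ContDiff ℝ ∞ φ) :
    (μ₀ + μ₂) * ∫ p, φ p * φ p ∂area
      + (μ₀ - μ₂) * (∫ p, e₀ p.1 * e₀ p.2 * φ p ∂area) ^ 2
      + (μ₁ - μ₂) * (∫ p, e₀ p.1 * e₁ p.2 * φ p ∂area) ^ 2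
      + (μ₁ - μ₂) * (∫ p, e₁ p.1 * e₀ p.2 * φ p ∂area) ^ 2
      + (2 * μ₁ - μ₀ - μ₂) * (∫ p, e₁ p.1 * e₁ p.2 * φ p ∂area) ^ 2
    ≤ ∫ p, (dx φ p * dx φ p + dy φ p * dy φ p) ∂area + h * ∫ p, φ p * φ p ∂arcLength := by
  have c0 := H.mode₀.continuous
  have c1 := H.mode₁.continuous
  have cφ := hφ.continuous
  have cx := continuous_dx hφ
  have cy := continuous_dy hφ
  have hx : ∀ y, μ₂ * ∫ x, φ (x, y) ^ 2 ∂edge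
        + (μ₀ - μ₂) * (∫ x, e₀ x * φ (x, y) ∂edge) ^ 2
        + (μ₁ - μ₂) * (∫ x, e₁ x * φ (x, y) ∂edge) ^ 2
      ≤ ∫ x, dx φ (x, y) ^ 2 ∂edge + h * (φ (π / 2, y) ^ 2 + φ (-(π / 2), y) ^ 2) := by
    intro y
    have := H.lower_bound (f := fun x => φ (x, y))
      ((hφ.comp (by fun_prop : ContDiff ℝ ∞ fun x : ℝ => (x, y))).of_le (by simp))
    simpa only [(hasDerivAt_fst hφ _ y).deriv] using this
  have hy : ∀ x, μ₂ * ∫ y, φ (x, y) ^ 2 ∂edge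
        + (μ₀ - μ₂) * (∫ y, e₀ y * φ (x, y) ∂edge) ^ 2
        + (μ₁ - μ₂) * (∫ y, e₁ y * φ (x, y) ∂edge) ^ 2
      ≤ ∫ y, dy φ (x, y) ^ 2 ∂edge + h * (φ (x, π / 2) ^ 2 + φ (x, -(π / 2)) ^ 2) := by
    intro x
    have := H.lower_bound (f := fun y => φ (x, y))
      ((hφ.comp (by fun_prop : ContDiff ℝ ∞ fun y : ℝ => (x, y))).of_le (by simp))
    simpa only [(hasDerivAt_snd hφ x _).deriv] using this
  have ca := continuous_integral_fst (F := fun z => e₀ z.1 * φ z) (by fun_prop)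
  have ca' := continuous_integral_fst (F := fun z => e₁ z.1 * φ z) (by fun_prop)
  have cb := continuous_integral_snd (F := fun z => e₀ z.2 * φ z) (by fun_prop)
  have cb' := continuous_integral_snd (F := fun z => e₁ z.2 * φ z) (by fun_prop)
  have d1 := continuous_integral_fst (F := fun z => φ z ^ 2) (by fun_prop)
  have d2 := continuous_integral_snd (F := fun z => φ z ^ 2) (by fun_prop)
  have d3 := continuous_integral_fst (F := fun z => dx φ z ^ 2) (by fun_prop)
  have d4 := continuous_integral_snd (F := fun z => dy φ z ^ 2) (by fun_prop)
  have ix := integral_mono (μ := edge) (integrable_edge (by fun_prop))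
    (integrable_edge (by fun_prop)) hx
  have iy := integral_mono (μ := edge) (integrable_edge (by fun_prop))
    (integrable_edge (by fun_prop)) hy
  rw [integral_add (integrable_edge (by fun_prop)) (integrable_edge (by fun_prop)),
    integral_add (integrable_edge (by fun_prop)) (integrable_edge (by fun_prop)),
    integral_add (integrable_edge (by fun_prop)) (integrable_edge (by fun_prop)),
    integral_const_mul, integral_const_mul, integral_const_mul, integral_const_mul] at ix iy
  rw [← integral_area (F := fun z => φ z ^ 2) (by fun_prop),
    ← integral_area (F := fun z => dx φ z ^ 2) (by fun_prop)] at ix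
  rw [← integral_area' (F := fun z => φ z ^ 2) (by fun_prop),
    ← integral_area' (F := fun z => dy φ z ^ 2) (by fun_prop)] at iy
  simp only [← sq]
  rw [integral_arcLength (F := fun z => φ z ^ 2) (by fun_prop),
    integral_add (integrable_area (by fun_prop)) (integrable_area (by fun_prop))]
  have bes := bessel_area cφ c0 c1 H.norm₀ H.norm₁ H.orth₀₁
  have ba := bessel_edge ca' c0 c1 H.norm₀ H.norm₁ H.orth₀₁
    (integral_mul_integral_fst cφ c1 c0) (integral_mul_integral_fst cφ c1 c1)
  have bb := bessel_edge cb' c0 c1 H.norm₀ H.norm₁ H.orth₀₁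
    (integral_mul_integral_snd cφ c0 c1) (integral_mul_integral_snd cφ c1 c1)
  -- The slice bounds weight the `e₀` projections by `μ₀ - μ₂` and the `e₁` projections by `μ₁ -
  -- μ₂`. Writing the latter as `(μ₀ - μ₂) + (μ₁ - μ₀)`, `bes` handles the common weight, while `ba`
  -- and `bb` bound the remainder from below. Each square ends with the coefficient (eigenvalue of
  -- its product) minus `μ₀ + μ₂`.
  have m1 := mul_le_mul_of_nonneg_left bes (show 0 ≤ μ₂ - μ₀ by linarith [H.lt, H.lt'])
  have m2 := mul_le_mul_of_nonneg_left ba (show 0 ≤ μ₁ - μ₀ by linarith [H.lt])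
  have m3 := mul_le_mul_of_nonneg_left bb (show 0 ≤ μ₁ - μ₀ by linarith [H.lt])
  linear_combination ix + iy + m1 + m2 + m3

end ModeTriple


/-! ### Passage from smooth functions to `H¹` -/

lemma tendsto_integral_mul {α : Type*} [MeasurableSpace α] {m : Measure α} {F G : ℕ → α → ℝ}
    {f g : α → ℝ} (hF : ∀ n, MemLp (F n) 2 m) (hG : ∀ n, MemLp (G n) 2 m) (hf : MemLp f 2 m)
    (hg : MemLp g 2 m) (tF : Tendsto (fun n => eLpNorm (fun x => F n x - f x) 2 m) atTop (𝓝 0))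
    (tG : Tendsto (fun n => eLpNorm (fun x => G n x - g x) 2 m) atTop (𝓝 0)) :
    Tendsto (fun n => ∫ x, F n x * G n x ∂m) atTop (𝓝 (∫ x, f x * g x ∂m)) := by
  have inner_eq : ∀ {a b : α → ℝ} (ha : MemLp a 2 m) (hb : MemLp b 2 m),
      inner ℝ (hb.toLp b) (ha.toLp a) = ∫ x, a x * b x ∂m := by
    intro a b ha hb
    rw [L2.inner_def]
    refine integral_congr_ae ?_
    filter_upwards [ha.coeFn_toLp, hb.coeFn_toLp] with x h1 h2
    rw [h1, h2]; rfl
  have t1 := (Lp.tendsto_Lp_iff_tendsto_eLpNorm'' F hF f hf).2 tF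
  have t2 := (Lp.tendsto_Lp_iff_tendsto_eLpNorm'' G hG g hg).2 tG
  simpa only [inner_eq] using t2.inner (𝕜 := ℝ) t1

lemma integral_mul_add_mul {α : Type*} [MeasurableSpace α] {m : Measure α} {a b c d : α → ℝ}
    (ha : MemLp a 2 m) (hb : MemLp b 2 m) (hc : MemLp c 2 m) (hd : MemLp d 2 m) :
    ∫ x, (a x * b x + c x * d x) ∂m = ∫ x, a x * b x ∂m + ∫ x, c x * d x ∂m :=
  integral_add (ha.integrable_mul hb) (hc.integrable_mul hd)

lemma tendsto_eLpNorm_sub_self {α : Type*} [MeasurableSpace α] (m : Measure α) (f : α → ℝ) :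
    Tendsto (fun _ : ℕ => eLpNorm (fun x => f x - f x) 2 m) atTop (𝓝 0) := by
  simp

section Smooth

variable {v : ℝ × ℝ → ℝ}

lemma integral_area_mul_fderiv (hv : ContDiff ℝ ∞ v) {φ : ℝ × ℝ → ℝ} (hφ : ContDiff ℝ ∞ φ)
    (hc : HasCompactSupport φ) (hs : tsupport φ ⊆ square) (w : ℝ × ℝ) :
    ∫ p, v p * fderiv ℝ φ p w ∂area = -∫ p, fderiv ℝ v p w * φ p ∂area := by
  have c1 : Continuous fun p => fderiv ℝ φ p w :=
    (hφ.continuous_fderiv (by simp)).clm_apply continuous_const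
  have c2 : Continuous fun p => fderiv ℝ v p w :=
    (hv.continuous_fderiv (by simp)).clm_apply continuous_const
  have c3 := hv.continuous
  have c4 := hφ.continuous
  have hc' : HasCompactSupport fun p => fderiv ℝ φ p w := hc.fderiv_apply (𝕜 := ℝ) w
  have key := integral_mul_fderiv_eq_neg_fderiv_mul_of_integrable (μ := volume) (f := v) (g := φ)
    (v := w) (Continuous.integrable_of_hasCompactSupport (by fun_prop) hc.mul_left)
    (Continuous.integrable_of_hasCompactSupport (by fun_prop) hc'.mul_left)
    (Continuous.integrable_of_hasCompactSupport (by fun_prop) hc.mul_left)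
    (fun p _ => hv.differentiable (by simp) p) (fun p _ => hφ.differentiable (by simp) p)
  have z1 : ∀ p, p ∉ square → φ p = 0 := fun p hp =>
    image_eq_zero_of_notMem_tsupport fun h => hp (hs h)
  have z2 : ∀ p, p ∉ square → fderiv ℝ φ p = 0 := fun p hp =>
    image_eq_zero_of_notMem_tsupport fun h => hp (hs (tsupport_fderiv_subset ℝ h))
  rw [area, setIntegral_eq_integral_of_forall_compl_eq_zero fun p hp => by simp [z2 p hp],
    setIntegral_eq_integral_of_forall_compl_eq_zero fun p hp => by simp [z1 p hp], key]

lemma isH1_of_contDiff (hv : ContDiff ℝ ∞ v) : IsH1 v (dx v) (dy v) where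
  memLp := memLp_area hv.continuous
  memLp_dx := memLp_area (continuous_dx hv)
  memLp_dy := memLp_area (continuous_dy hv)
  weak_dx _ hφ hc hs := integral_area_mul_fderiv hv hφ hc hs _
  weak_dy _ hφ hc hs := integral_area_mul_fderiv hv hφ hc hs _

lemma isTrace_of_contDiff (hv : ContDiff ℝ ∞ v) : IsTrace v (dx v) (dy v) v :=
  ⟨memLp_arcLength hv.continuous, fun _ => v, fun _ => hv, by simp, by simp, by simp, by simp⟩

end Smooth

namespace IsSmoothMode

variable {h μ l : ℝ} {v u : ℝ × ℝ → ℝ}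

/-- A smooth mode satisfies the weak Robin equation against every `H¹` function. -/
lemma weak_of_isH1 (hv : IsSmoothMode h μ v) {w w₁ w₂ s : ℝ × ℝ → ℝ} (hw : IsH1 w w₁ w₂)
    (hs : IsTrace w w₁ w₂ s) :
    ∫ p, (dx v p * w₁ p + dy v p * w₂ p) ∂area + h * ∫ p, v p * s p ∂arcLength =
      μ * ∫ p, v p * w p ∂area := by
  obtain ⟨ms, φ, hφ, t0, t1, t2, t3⟩ := hs
  have m0 := memLp_area hv.contDiff.continuous
  have m1 := memLp_area (continuous_dx hv.contDiff)
  have m2 := memLp_area (continuous_dy hv.contDiff)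
  have m3 := memLp_arcLength hv.contDiff.continuous
  have p0 := fun n => memLp_area (hφ n).continuous
  have p1 := fun n => memLp_area (continuous_dx (hφ n))
  have p2 := fun n => memLp_area (continuous_dy (hφ n))
  have p3 := fun n => memLp_arcLength (hφ n).continuous
  have l0 := tendsto_integral_mul (fun _ => m0) p0 m0 hw.memLp (tendsto_eLpNorm_sub_self _ _) t0
  have l1 := tendsto_integral_mul (fun _ => m1) p1 m1 hw.memLp_dx
    (tendsto_eLpNorm_sub_self _ _) t1
  have l2 := tendsto_integral_mul (fun _ => m2) p2 m2 hw.memLp_dy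
    (tendsto_eLpNorm_sub_self _ _) t2
  have l3 := tendsto_integral_mul (fun _ => m3) p3 m3 ms (tendsto_eLpNorm_sub_self _ _) t3
  have key := fun n => hv.weak (φ n) (hφ n)
  simp only [integral_mul_add_mul m1 (p1 _) m2 (p2 _)] at key
  rw [integral_mul_add_mul m1 hw.memLp_dx m2 hw.memLp_dy]
  refine tendsto_nhds_unique ((l1.add l2).add (l3.const_mul h)) ?_
  simpa only [key] using! l0.const_mul μ

lemma isRobinEigenfunction (hv : IsSmoothMode h μ v) (h0 : ¬ v =ᵐ[area] 0) :
    IsRobinEigenfunction h μ v :=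
  ⟨h0, dx v, dy v, v, isH1_of_contDiff hv.contDiff, isTrace_of_contDiff hv.contDiff,
    fun _ _ _ _ hw hs => hv.weak_of_isH1 hw hs⟩

/-- Symmetry of the Robin form: each function serves as test function for the other. -/
lemma integral_mul_eq_zero (hv : IsSmoothMode h μ v) (hu : IsRobinEigenfunction h l u)
    (hne : l ≠ μ) : ∫ p, v p * u p ∂area = 0 := by
  obtain ⟨-, g₁, g₂, t, hH, ht, hweak⟩ := hu
  have h1 := hweak v _ _ _ (isH1_of_contDiff hv.contDiff) (isTrace_of_contDiff hv.contDiff)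
  have h2 := hv.weak_of_isH1 hH ht
  simp only [mul_comm (g₁ _), mul_comm (g₂ _), mul_comm (t _), mul_comm (u _)] at h1
  have : (l - μ) * ∫ p, v p * u p ∂area = 0 := by linarith
  exact (mul_eq_zero.1 this).resolve_left (sub_ne_zero.2 hne)

end IsSmoothMode

/-- Needed because `eigenvalueCount` tests the chosen representative of an `Lp` class, not the
smooth product itself. -/
lemma IsRobinEigenfunction.congr {h l : ℝ} {u v : ℝ × ℝ → ℝ} (hu : IsRobinEigenfunction h l u)
    (huv : u =ᵐ[area] v) : IsRobinEigenfunction h l v := by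
  obtain ⟨h0, g₁, g₂, t, hH, ⟨mt, φ, hφ, t0, t1⟩, hweak⟩ := hu
  refine ⟨fun hv => h0 (huv.trans hv), g₁, g₂, t,
    ⟨hH.memLp.ae_eq huv, hH.memLp_dx, hH.memLp_dy, fun φ h1 h2 h3 => ?_, fun φ h1 h2 h3 => ?_⟩,
    ⟨mt, φ, hφ, ?_, t1⟩, fun w w₁ w₂ s hw hs => ?_⟩
  · rw [← hH.weak_dx φ h1 h2 h3]
    exact integral_congr_ae (huv.symm.mono fun p hp => by simp only [hp])
  · rw [← hH.weak_dy φ h1 h2 h3]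
    exact integral_congr_ae (huv.symm.mono fun p hp => by simp only [hp])
  · refine t0.congr fun n => eLpNorm_congr_ae (huv.mono fun p hp => by simp only [hp])
  · rw [hweak w w₁ w₂ s hw hs]
    congr 1
    exact integral_congr_ae (huv.mono fun p hp => by simp only [hp])

/-- The equality case of Bessel's inequality: the residual has norm zero. -/
lemma eq_sum_inner_of_norm_sq_le {E ι : Type*} [NormedAddCommGroup E] [InnerProductSpace ℝ E]
    [Fintype ι] {w : ι → E} (hw : Orthonormal ℝ w) {u : E}
    (hu : ‖u‖ ^ 2 ≤ ∑ i, inner ℝ (w i) u ^ 2) : u = ∑ i, inner ℝ (w i) u • w i := by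
  have h1 : inner ℝ u (∑ i, inner ℝ (w i) u • w i) = ∑ i, inner ℝ (w i) u ^ 2 := by
    rw [inner_sum]
    refine Finset.sum_congr rfl fun i _ => ?_
    rw [real_inner_smul_right, real_inner_comm, sq]
  have h2 : ‖∑ i, inner ℝ (w i) u • w i‖ ^ 2 = ∑ i, inner ℝ (w i) u ^ 2 := by
    rw [← real_inner_self_eq_norm_sq, hw.inner_sum]
    exact Finset.sum_congr rfl fun i _ => by simp [sq]
  have h3 : ‖u - ∑ i, inner ℝ (w i) u • w i‖ ^ 2 ≤ 0 := by
    rw [norm_sub_sq_real, h1, h2]; linarith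
  exact sub_eq_zero.1 (norm_eq_zero.1 (pow_eq_zero_iff two_ne_zero |>.1
    (le_antisymm h3 (sq_nonneg _))))

/-! ### The spectrum up to `μ₀ + μ₂` and the indices of the two eigenvalues -/

namespace ModeTriple

variable {h μ₀ μ₁ μ₂ : ℝ} {e₀ e₁ e₂ : ℝ → ℝ}

lemma isMode (H : ModeTriple h μ₀ μ₁ μ₂ e₀ e₁ e₂) (i : Fin 3) :
    IsMode h (![μ₀, μ₁, μ₂] i) (![e₀, e₁, e₂] i) := by
  fin_cases i
  exacts [H.mode₀, H.mode₁, H.mode₂]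

lemma integral_mul (H : ModeTriple h μ₀ μ₁ μ₂ e₀ e₁ e₂) (i j : Fin 3) :
    ∫ x, ![e₀, e₁, e₂] i x * ![e₀, e₁, e₂] j x ∂edge = if i = j then 1 else 0 := by
  have h1 := H.orth₀₁
  have h2 := H.orth₀₂
  have h3 := H.orth₁₂
  have h1' := H.orth₀₁
  have h2' := H.orth₀₂
  have h3' := H.orth₁₂
  simp only [mul_comm (e₀ _)] at h1' h2'
  simp only [mul_comm (e₁ _) (e₂ _)] at h3'
  have n0 := H.norm₀
  have n1 := H.norm₁
  have n2 := H.norm₂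
  simp only [sq] at n0 n1 n2
  fin_cases i <;> fin_cases j <;> simp [*]

lemma isSmoothMode (H : ModeTriple h μ₀ μ₁ μ₂ e₀ e₁ e₂) (i : Fin 3 × Fin 3) :
    IsSmoothMode h (![μ₀, μ₁, μ₂] i.1 + ![μ₀, μ₁, μ₂] i.2)
      (fun p => ![e₀, e₁, e₂] i.1 p.1 * ![e₀, e₁, e₂] i.2 p.2) :=
  (H.isMode i.1).tensor (H.isMode i.2)

/-- The product modes as elements of `L²`. -/
def product (H : ModeTriple h μ₀ μ₁ μ₂ e₀ e₁ e₂) (i : Fin 3 × Fin 3) : Lp ℝ 2 area :=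
  (memLp_area (H.isSmoothMode i).contDiff.continuous).toLp _

lemma coeFn_product (H : ModeTriple h μ₀ μ₁ μ₂ e₀ e₁ e₂) (i : Fin 3 × Fin 3) :
    H.product i =ᵐ[area] fun p => ![e₀, e₁, e₂] i.1 p.1 * ![e₀, e₁, e₂] i.2 p.2 :=
  MemLp.coeFn_toLp _

lemma inner_product (H : ModeTriple h μ₀ μ₁ μ₂ e₀ e₁ e₂) (i : Fin 3 × Fin 3)
    (u : Lp ℝ 2 area) : inner ℝ (H.product i) u =
      ∫ p, ![e₀, e₁, e₂] i.1 p.1 * ![e₀, e₁, e₂] i.2 p.2 * u p ∂area := by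
  rw [L2.inner_def]
  refine integral_congr_ae ?_
  filter_upwards [H.coeFn_product i] with p hp
  rw [hp]; exact mul_comm _ _

lemma orthonormal_product (H : ModeTriple h μ₀ μ₁ μ₂ e₀ e₁ e₂) : Orthonormal ℝ H.product := by
  rw [orthonormal_iff_ite]
  intro i j
  rw [H.inner_product]
  have c := fun i => (H.isMode i).continuous
  have c1 := c i.1
  have c2 := c i.2
  have c3 := c j.1
  have c4 := c j.2
  have : ∫ p, ![e₀, e₁, e₂] i.1 p.1 * ![e₀, e₁, e₂] i.2 p.2 * H.product j p ∂area
      = ∫ p, ![e₀, e₁, e₂] i.1 p.1 * ![e₀, e₁, e₂] i.2 p.2 *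
        (![e₀, e₁, e₂] j.1 p.1 * ![e₀, e₁, e₂] j.2 p.2) ∂area :=
    integral_congr_ae ((H.coeFn_product j).mono fun p hp => by simp only [hp])
  rw [this, ← integral_mul_integral_fst (by fun_prop) c1 c2]
  have h2 : ∀ y, ∫ x, ![e₀, e₁, e₂] i.1 x * (![e₀, e₁, e₂] j.1 x * ![e₀, e₁, e₂] j.2 y) ∂edge
      = (if i.1 = j.1 then 1 else 0) * ![e₀, e₁, e₂] j.2 y := fun y => by
    simp only [← mul_assoc]
    rw [integral_mul_const, H.integral_mul]
  simp only [h2, mul_left_comm (![e₀, e₁, e₂] i.2 _)]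
  rw [integral_const_mul, H.integral_mul]
  by_cases h1 : i.1 = j.1 <;> by_cases h2 : i.2 = j.2 <;> simp [h1, h2, Prod.ext_iff]

lemma isRobinEigenfunction_product (H : ModeTriple h μ₀ μ₁ μ₂ e₀ e₁ e₂) (i : Fin 3 × Fin 3) :
    IsRobinEigenfunction h (![μ₀, μ₁, μ₂] i.1 + ![μ₀, μ₁, μ₂] i.2) (H.product i) := by
  refine ((H.isSmoothMode i).isRobinEigenfunction fun h0 => ?_).congr (H.coeFn_product i).symm
  have : H.product i = 0 := (Lp.eq_zero_iff_ae_eq_zero).2 ((H.coeFn_product i).trans h0)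
  exact H.orthonormal_product.ne_zero i this

/-- The spectral lower bound, for `H¹` functions. -/
lemma lower_bound_of_isH1 (H : ModeTriple h μ₀ μ₁ μ₂ e₀ e₁ e₂) {u g₁ g₂ t : ℝ × ℝ → ℝ}
    (hu : IsH1 u g₁ g₂) (ht : IsTrace u g₁ g₂ t) :
    (μ₀ + μ₂) * ∫ p, u p * u p ∂area
      + (μ₀ - μ₂) * (∫ p, e₀ p.1 * e₀ p.2 * u p ∂area) ^ 2
      + (μ₁ - μ₂) * (∫ p, e₀ p.1 * e₁ p.2 * u p ∂area) ^ 2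
      + (μ₁ - μ₂) * (∫ p, e₁ p.1 * e₀ p.2 * u p ∂area) ^ 2
      + (2 * μ₁ - μ₀ - μ₂) * (∫ p, e₁ p.1 * e₁ p.2 * u p ∂area) ^ 2
    ≤ ∫ p, (g₁ p * g₁ p + g₂ p * g₂ p) ∂area + h * ∫ p, t p * t p ∂arcLength := by
  obtain ⟨mt, φ, hφ, t0, t1, t2, t3⟩ := ht
  have p0 := fun n => memLp_area (hφ n).continuous
  have p1 := fun n => memLp_area (continuous_dx (hφ n))
  have p2 := fun n => memLp_area (continuous_dy (hφ n))
  have p3 := fun n => memLp_arcLength (hφ n).continuous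
  have l0 := tendsto_integral_mul p0 p0 hu.memLp hu.memLp t0 t0
  have l1 := tendsto_integral_mul p1 p1 hu.memLp_dx hu.memLp_dx t1 t1
  have l2 := tendsto_integral_mul p2 p2 hu.memLp_dy hu.memLp_dy t2 t2
  have l3 := tendsto_integral_mul p3 p3 mt mt t3 t3
  have lc : ∀ {e k : ℝ → ℝ}, Continuous e → Continuous k →
      Tendsto (fun n => ∫ p, e p.1 * k p.2 * φ n p ∂area) atTop
        (𝓝 (∫ p, e p.1 * k p.2 * u p ∂area)) := fun he hk =>
    have m := memLp_area (F := fun p => _ * _)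
      ((he.comp continuous_fst).mul (hk.comp continuous_snd))
    tendsto_integral_mul (fun _ => m) p0 m hu.memLp (tendsto_eLpNorm_sub_self _ _) t0
  have c0 := H.mode₀.continuous
  have c1 := H.mode₁.continuous
  have key := fun n => H.lower_bound_area (hφ n)
  simp only [integral_mul_add_mul (p1 _) (p1 _) (p2 _) (p2 _)] at key
  rw [integral_mul_add_mul hu.memLp_dx hu.memLp_dx hu.memLp_dy hu.memLp_dy]
  exact le_of_tendsto_of_tendsto' (((((l0.const_mul _).add (((lc c0 c0).pow 2).const_mul _)).add
    (((lc c0 c1).pow 2).const_mul _)).add (((lc c1 c0).pow 2).const_mul _)).add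
    (((lc c1 c1).pow 2).const_mul _)) ((l1.add l2).add (l3.const_mul h)) key

/-- An eigenfunction below `μ₀ + μ₂` is a combination of the four lowest product modes. -/
lemma eq_sum_of_lt (H : ModeTriple h μ₀ μ₁ μ₂ e₀ e₁ e₂) {l : ℝ} {u : Lp ℝ 2 area}
    (hu : IsRobinEigenfunction h l u) (hl : l < μ₀ + μ₂) :
    u = inner ℝ (H.product (0, 0)) u • H.product (0, 0)
      + inner ℝ (H.product (0, 1)) u • H.product (0, 1)
      + inner ℝ (H.product (1, 0)) u • H.product (1, 0)
      + inner ℝ (H.product (1, 1)) u • H.product (1, 1) := by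
  have hon := H.orthonormal_product.comp (![(0, 0), (0, 1), (1, 0), (1, 1)] : Fin 4 → _)
    (by decide)
  have key := eq_sum_inner_of_norm_sq_le hon (u := u) ?_
  · simpa only [Fin.sum_univ_four] using! key
  -- Either the eigenvalues agree or the coefficient vanishes. So in the lower bound each product's
  -- eigenvalue may be replaced by `l`, and the common factor `μ₀ + μ₂ - l > 0` cancels, leaving the
  -- reverse of Bessel's inequality.
  have horth : ∀ i : Fin 3 × Fin 3,
      (![μ₀, μ₁, μ₂] i.1 + ![μ₀, μ₁, μ₂] i.2 - l) * inner ℝ (H.product i) u ^ 2 = 0 := by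
    intro i
    by_cases hi : l = ![μ₀, μ₁, μ₂] i.1 + ![μ₀, μ₁, μ₂] i.2
    · rw [hi]; ring
    · rw [H.inner_product, (H.isSmoothMode i).integral_mul_eq_zero hu hi]; ring
  obtain ⟨-, g₁, g₂, t, hH, ht, hweak⟩ := hu
  have h1 := hweak _ _ _ _ hH ht
  have h2 := H.lower_bound_of_isH1 hH ht
  have hnorm : ∫ p, u p * u p ∂area = ‖u‖ ^ 2 := by
    rw [← real_inner_self_eq_norm_sq, L2.inner_def]; rfl
  rw [h1, hnorm] at h2
  have i00 := H.inner_product (0, 0) u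
  have i01 := H.inner_product (0, 1) u
  have i10 := H.inner_product (1, 0) u
  have i11 := H.inner_product (1, 1) u
  have o00 := horth (0, 0)
  have o01 := horth (0, 1)
  have o10 := horth (1, 0)
  have o11 := horth (1, 1)
  simp only [Matrix.cons_val_zero, Matrix.cons_val_one] at i00 i01 i10 i11 o00 o01 o10 o11
  rw [← i00, ← i01, ← i10, ← i11] at h2
  simp only [Fin.sum_univ_four]
  change ‖u‖ ^ 2 ≤ inner ℝ (H.product (0, 0)) u ^ 2 + inner ℝ (H.product (0, 1)) u ^ 2
    + inner ℝ (H.product (1, 0)) u ^ 2 + inner ℝ (H.product (1, 1)) u ^ 2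
  refine le_of_mul_le_mul_left ?_ (sub_pos.2 hl)
  linear_combination h2 - o00 - o01 - o10 - o11

lemma inner_product_eq_zero (H : ModeTriple h μ₀ μ₁ μ₂ e₀ e₁ e₂) {l : ℝ} {u : Lp ℝ 2 area}
    (hu : IsRobinEigenfunction h l u) (i : Fin 3 × Fin 3)
    (hl : l ≠ ![μ₀, μ₁, μ₂] i.1 + ![μ₀, μ₁, μ₂] i.2) : inner ℝ (H.product i) u = 0 := by
  rw [H.inner_product, (H.isSmoothMode i).integral_mul_eq_zero hu hl]

lemma le_eigenvalueCount (H : ModeTriple h μ₀ μ₁ μ₂ e₀ e₁ e₂) {n : ℕ} {s : Fin n → Fin 3 × Fin 3}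
    (hs : Function.Injective s) {A : Set ℝ}
    (hA : ∀ k, ![μ₀, μ₁, μ₂] (s k).1 + ![μ₀, μ₁, μ₂] (s k).2 ∈ A) :
    (n : Cardinal) ≤ eigenvalueCount h A := by
  have hli := (H.orthonormal_product.comp s hs).linearIndependent
  have h1 := rank_span hli
  rw [Cardinal.mk_range_eq _ hli.injective, Cardinal.mk_fin] at h1
  rw [← h1]
  refine Submodule.rank_mono (Submodule.span_mono ?_)
  rintro _ ⟨k, rfl⟩
  exact ⟨_, hA k, H.isRobinEigenfunction_product (s k)⟩

lemma eigenvalueCount_le (H : ModeTriple h μ₀ μ₁ μ₂ e₀ e₁ e₂) {n : ℕ} {s : Fin n → Fin 3 × Fin 3}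
    {A : Set ℝ} (hA : ∀ l ∈ A, ∀ u : Lp ℝ 2 area, IsRobinEigenfunction h l u →
      u ∈ Submodule.span ℝ (Set.range (H.product ∘ s))) :
    eigenvalueCount h A ≤ n := by
  refine (Submodule.rank_mono (Submodule.span_le.2 ?_)).trans
    ((rank_span_le (Set.range (H.product ∘ s))).trans ?_)
  · rintro u ⟨l, hl, hu⟩
    exact hA l hl u hu
  · simpa using Cardinal.mk_range_le (f := H.product ∘ s)

lemma isNthEigenvalue_four (H : ModeTriple h μ₀ μ₁ μ₂ e₀ e₁ e₂) :
    IsNthEigenvalue h 4 (μ₁ + μ₁) := by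
  have hlt := H.lt
  constructor
  · refine (H.eigenvalueCount_le (s := ![(0, 0), (0, 1), (1, 0)]) fun l hl u hu => ?_).trans_lt
      (Nat.cast_lt.2 (by norm_num))
    have h1 := H.eq_sum_of_lt hu (lt_of_lt_of_le hl (by linarith [H.gap]))
    -- An eigenvalue strictly below `2μ₁` forces orthogonality to the product `(1, 1)`, so only
    -- three products remain.
    rw [H.inner_product_eq_zero hu (1, 1) (by simpa using ne_of_lt hl), zero_smul, add_zero] at h1
    rw [h1]
    have hmem : ∀ k, H.product ((![(0, 0), (0, 1), (1, 0)] : Fin 3 → _) k) ∈ Submodule.span ℝ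
        (Set.range (H.product ∘ (![(0, 0), (0, 1), (1, 0)] : Fin 3 → _))) := fun k =>
      Submodule.subset_span ⟨k, rfl⟩
    exact add_mem (add_mem (Submodule.smul_mem _ _ (hmem 0)) (Submodule.smul_mem _ _ (hmem 1)))
      (Submodule.smul_mem _ _ (hmem 2))
  · refine H.le_eigenvalueCount (s := ![(0, 0), (0, 1), (1, 0), (1, 1)]) (by decide) fun k => ?_
    fin_cases k <;> simp <;> linarith

lemma isNthEigenvalue_five (H : ModeTriple h μ₀ μ₁ μ₂ e₀ e₁ e₂) :
    IsNthEigenvalue h 5 (μ₀ + μ₂) := by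
  have hlt := H.lt
  have hlt' := H.lt'
  have hgap := H.gap
  constructor
  -- Four is only an upper bound here: if `2μ₁ = μ₀ + μ₂`, the product `(1, 1)` is not below the
  -- threshold, and the fourth and fifth eigenvalues coincide.
  · refine (H.eigenvalueCount_le (s := ![(0, 0), (0, 1), (1, 0), (1, 1)])
      fun l hl u hu => ?_).trans_lt (Nat.cast_lt.2 (by norm_num))
    rw [H.eq_sum_of_lt hu hl]
    have hmem : ∀ k, H.product ((![(0, 0), (0, 1), (1, 0), (1, 1)] : Fin 4 → _) k) ∈
        Submodule.span ℝ
        (Set.range (H.product ∘ (![(0, 0), (0, 1), (1, 0), (1, 1)] : Fin 4 → _))) := fun k =>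
      Submodule.subset_span ⟨k, rfl⟩
    exact add_mem (add_mem (add_mem (Submodule.smul_mem _ _ (hmem 0))
      (Submodule.smul_mem _ _ (hmem 1))) (Submodule.smul_mem _ _ (hmem 2)))
      (Submodule.smul_mem _ _ (hmem 3))
  · refine H.le_eigenvalueCount (s := ![(0, 0), (0, 1), (1, 0), (1, 1), (0, 2)]) (by decide)
      fun k => ?_
    fin_cases k <;> simp <;> linarith

end ModeTriple


/-! ### Counting components; reflections into the four quadrants -/

/-- A continuous map to a discrete space is constant on components, and preconnected fibres make the
induced map on components injective. -/
lemma card_connectedComponents_of_continuous {X ι : Type*} [TopologicalSpace X]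
    [TopologicalSpace ι] [DiscreteTopology ι] {f : X → ι} (hf : Continuous f)
    (hs : Function.Surjective f) (hp : ∀ i, IsPreconnected (f ⁻¹' {i})) :
    ENat.card (ConnectedComponents X) = ENat.card ι := by
  refine ENat.card_congr (Equiv.ofBijective hf.connectedComponentsLift ⟨?_, fun i => ?_⟩)
  · intro a b hab
    obtain ⟨x, rfl⟩ := ConnectedComponents.surjective_coe a
    obtain ⟨y, rfl⟩ := ConnectedComponents.surjective_coe b
    simp only [hf.connectedComponentsLift_apply_coe] at hab
    exact ConnectedComponents.coe_eq_coe'.2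
      ((hp (f y)).subset_connectedComponent (by simp) (by simp [hab]))
  · obtain ⟨x, rfl⟩ := hs i
    exact ⟨x, hf.connectedComponentsLift_apply_coe x⟩

/-- The number of components of a set that is split into nonempty connected open pieces. -/
lemma card_connectedComponents_of_partition {E ι : Type*} [TopologicalSpace E] {p : E → Prop}
    {V : ι → Set E} (ho : ∀ i, IsOpen (V i)) (hp : ∀ i, IsPreconnected (V i))
    (hne : ∀ i, (V i).Nonempty) (hd : ∀ i j x, x ∈ V i → x ∈ V j → i = j)
    (hV : ∀ x, p x ↔ ∃ i, x ∈ V i) :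
    ENat.card (ConnectedComponents {x // p x}) = ENat.card ι := by
  choose f hf using fun x : {x // p x} => (hV x).1 x.2
  have hpre : ∀ i, f ⁻¹' {i} = Subtype.val ⁻¹' V i := fun i => by
    ext x
    exact ⟨fun h => by rw [← show f x = i from h]; exact hf x, fun h => hd _ _ _ (hf x) h⟩
  let _ : TopologicalSpace ι := ⊥
  have : DiscreteTopology ι := ⟨rfl⟩
  refine card_connectedComponents_of_continuous (f := f)
    (continuous_discrete_rng.2 fun i => ?_) (fun i => ?_) fun i => ?_
  · rw [hpre]; exact (ho i).preimage continuous_subtype_val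
  · obtain ⟨x, hx⟩ := hne i
    exact ⟨⟨x, (hV x).2 ⟨i, hx⟩⟩, hd _ _ _ (hf _) hx⟩
  · rw [hpre]
    refine (Topology.IsInducing.isPreconnected_image
      (f := (Subtype.val : {x // p x} → E)) ⟨rfl⟩).1 ?_
    rw [image_preimage_eq_of_subset fun x hx => ⟨⟨x, (hV x).2 ⟨i, hx⟩⟩, rfl⟩]
    exact hp i

/-- The sign attached to a Boolean. -/
def sgn (i : Bool) : ℝ := cond i 1 (-1)

lemma sgn_mul_self (i : Bool) : sgn i * sgn i = 1 := by cases i <;> simp [sgn]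

lemma sgn_mul_sgn_mul (i : Bool) (x : ℝ) : sgn i * (sgn i * x) = x := by
  rw [← mul_assoc, sgn_mul_self, one_mul]

lemma eq_of_sgn_mul_pos {i j : Bool} {x : ℝ} (hi : 0 < sgn i * x) (hj : 0 < sgn j * x) :
    i = j := by
  cases i <;> cases j <;> simp [sgn] at hi hj ⊢ <;> linarith

lemma exists_sgn_mul_mem {x c : ℝ} (hx : x ∈ Ioo (-c) c) (h0 : x ≠ 0) :
    ∃ i, sgn i * x ∈ Ioo 0 c := by
  rcases h0.lt_or_gt with h | h
  · exact ⟨false, by simpa [sgn] using ⟨h, by linarith [hx.1]⟩⟩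
  · exact ⟨true, by simpa [sgn] using ⟨h, hx.2⟩⟩

lemma mem_of_sgn_mul_mem {i : Bool} {x c : ℝ} (hx : sgn i * x ∈ Ioo 0 c) :
    x ∈ Ioo (-c) c ∧ x ≠ 0 := by
  cases i <;> simp only [sgn, cond_true, cond_false, mem_Ioo] at hx ⊢ <;>
    refine ⟨⟨by linarith, by linarith⟩, ?_⟩ <;> rintro rfl <;> norm_num at hx

/-- The part of a set in the open first quadrant, moved to the quadrant with the given signs. -/
def quadrant (W : Set (ℝ × ℝ)) (i : Bool × Bool) : Set (ℝ × ℝ) :=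
  {p | (sgn i.1 * p.1, sgn i.2 * p.2) ∈ W}

section Quadrant

variable {W : Set (ℝ × ℝ)}

lemma quadrant_eq_image (W : Set (ℝ × ℝ)) (i : Bool × Bool) :
    quadrant W i = (fun p : ℝ × ℝ => (sgn i.1 * p.1, sgn i.2 * p.2)) '' W := by
  ext p
  constructor
  · intro hp
    exact ⟨_, hp, by simp [sgn_mul_sgn_mul]⟩
  · rintro ⟨q, hq, rfl⟩
    simpa [quadrant, sgn_mul_sgn_mul] using hq

lemma isOpen_quadrant (hW : IsOpen W) (i : Bool × Bool) : IsOpen (quadrant W i) :=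
  hW.preimage (by fun_prop)

lemma isPreconnected_quadrant (hW : IsPreconnected W) (i : Bool × Bool) :
    IsPreconnected (quadrant W i) := by
  rw [quadrant_eq_image]
  exact hW.image _ (by fun_prop)

lemma nonempty_quadrant (hW : W.Nonempty) (i : Bool × Bool) : (quadrant W i).Nonempty := by
  rw [quadrant_eq_image]
  exact hW.image _

lemma quadrant_disjoint (hW : ∀ p ∈ W, 0 < p.1 ∧ 0 < p.2) {i j : Bool × Bool} {p : ℝ × ℝ}
    (hi : p ∈ quadrant W i) (hj : p ∈ quadrant W j) : i = j :=
  Prod.ext (eq_of_sgn_mul_pos (hW _ hi).1 (hW _ hj).1)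
    (eq_of_sgn_mul_pos (hW _ hi).2 (hW _ hj).2)

end Quadrant

lemma apply_sgn_mul {g : ℝ → ℝ} (hg : ∀ x, g (-x) = g x) (i : Bool) (x : ℝ) :
    g (sgn i * x) = g x := by
  cases i <;> simp [sgn, hg]

lemma not_ae_eq_zero {v : ℝ × ℝ → ℝ} (hv : Continuous v) {p : ℝ × ℝ} (hp : p ∈ square)
    (h0 : v p ≠ 0) : ¬ v =ᵐ[area] 0 := fun h =>
  h0 (Measure.eqOn_open_of_ae_eq h (isOpen_Ioo.prod isOpen_Ioo) hv.continuousOn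
    continuousOn_const hp)

/-- The sum `g(x) + g(y)`, for an even function `g` that decreases on `[0, c]` from a value greater
than `-g(c)` to `g(c) < 0`: its positive part is connected. -/
lemma isPreconnected_pos {g : ℝ → ℝ} {c : ℝ} (he : ∀ x, g (-x) = g x)
    (ha : AntitoneOn g (Icc 0 c)) :
    IsPreconnected {p : ℝ × ℝ | p ∈ Ioo (-c) c ×ˢ Ioo (-c) c ∧ 0 < g p.1 + g p.2} := by
  have habs : ∀ x, g |x| = g x := fun x => by
    rcases abs_choice x with h | h <;> rw [h]; exact he x
  have hmono : ∀ x ∈ Ioo (-c) c, ∀ t ∈ Icc (0 : ℝ) 1, g x ≤ g (t * x) := by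
    intro x hx t ht
    have hx' : |x| < c := abs_lt.2 hx
    rw [← habs x, ← habs (t * x), abs_mul, abs_of_nonneg ht.1]
    have h1 : t * |x| ≤ |x| := mul_le_of_le_one_left (abs_nonneg x) ht.2
    exact ha ⟨mul_nonneg ht.1 (abs_nonneg x), h1.trans hx'.le⟩ ⟨abs_nonneg x, hx'.le⟩ h1
  have hscale : ∀ x ∈ Ioo (-c) c, ∀ t ∈ Icc (0 : ℝ) 1, t * x ∈ Ioo (-c) c := by
    intro x hx t ht
    have hx' : |x| < c := abs_lt.2 hx
    refine abs_lt.1 ?_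
    rw [abs_mul, abs_of_nonneg ht.1]
    exact (mul_le_of_le_one_left (abs_nonneg x) ht.2).trans_lt hx'
  -- The positive part is star-shaped about the origin, since shrinking a point toward 0 can only
  -- increase `g` in each coordinate.
  refine isPreconnected_of_forall (0 : ℝ × ℝ) fun p hp => ?_
  refine ⟨(fun t : ℝ => (t * p.1, t * p.2)) '' Icc 0 1, ?_, ⟨0, by simp, by simp [Prod.ext_iff]⟩,
    ⟨1, by simp, by simp⟩, isPreconnected_Icc.image _ (by fun_prop)⟩
  rintro _ ⟨t, ht, rfl⟩
  exact ⟨⟨hscale _ hp.1.1 t ht, hscale _ hp.1.2 t ht⟩,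
    hp.2.trans_le (add_le_add (hmono _ hp.1.1 t ht) (hmono _ hp.1.2 t ht))⟩

/-- The negative part of `g(x) + g(y)` in a corner is connected, if `g` is decreasing. -/
lemma isPreconnected_neg {g : ℝ → ℝ} {c : ℝ} (ha : AntitoneOn g (Icc 0 c)) :
    IsPreconnected {p : ℝ × ℝ | p ∈ Ioo 0 c ×ˢ Ioo 0 c ∧ g p.1 + g p.2 < 0} := by
  set V := {p : ℝ × ℝ | p ∈ Ioo 0 c ×ˢ Ioo 0 c ∧ g p.1 + g p.2 < 0}
  have up : ∀ p ∈ V, ∀ q : ℝ × ℝ, p.1 ≤ q.1 → p.2 ≤ q.2 → q.1 < c → q.2 < c → q ∈ V := by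
    intro p hp q h1 h2 h3 h4
    refine ⟨⟨⟨hp.1.1.1.trans_le h1, h3⟩, ⟨hp.1.2.1.trans_le h2, h4⟩⟩, ?_⟩
    have m1 := ha ⟨hp.1.1.1.le, hp.1.1.2.le⟩ ⟨(hp.1.1.1.trans_le h1).le, h3.le⟩ h1
    have m2 := ha ⟨hp.1.2.1.le, hp.1.2.2.le⟩ ⟨(hp.1.2.1.trans_le h2).le, h4.le⟩ h2
    have := hp.2
    linarith
  have seg : ∀ p ∈ V, ∀ q : ℝ × ℝ, p.1 ≤ q.1 → p.2 ≤ q.2 → q.1 < c → q.2 < c →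
      segment ℝ p q ⊆ V := by
    intro p hp q h1 h2 h3 h4 r hr
    have hr' := segment_subset_Icc (show p ≤ q from ⟨h1, h2⟩) hr
    exact up p hp r hr'.1.1 hr'.1.2 (hr'.2.1.trans_lt h3) (hr'.2.2.trans_lt h4)
  refine isPreconnected_of_forall_pair fun p hp q hq => ?_
  -- The negative part is closed under increasing the coordinates within the open square, so two
  -- points are joined through their coordinatewise maximum.
  set m : ℝ × ℝ := p ⊔ q
  have m1 : m.1 < c := max_lt hp.1.1.2 hq.1.1.2
  have m2 : m.2 < c := max_lt hp.1.2.2 hq.1.2.2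
  have hpm : p ≤ m := le_sup_left
  have hqm : q ≤ m := le_sup_right
  refine ⟨segment ℝ p m ∪ segment ℝ q m,
    union_subset (seg p hp m hpm.1 hpm.2 m1 m2) (seg q hq m hqm.1 hqm.2 m1 m2),
    Or.inl (left_mem_segment ℝ p m), Or.inr (left_mem_segment ℝ q m), ?_⟩
  exact IsPreconnected.union m (right_mem_segment ℝ p m) (right_mem_segment ℝ q m)
    (convex_segment p m).isPreconnected (convex_segment q m).isPreconnected

/-! ### Nodal domains of the two eigenfunctions -/

namespace ModeTriple

variable {h μ₀ μ₁ μ₂ : ℝ} {e₀ e₁ e₂ : ℝ → ℝ}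

lemma ne_zero_iff (H : ModeTriple h μ₀ μ₁ μ₂ e₀ e₁ e₂) {x : ℝ}
    (hx : x ∈ Ioo (-(π / 2)) (π / 2)) : e₁ x ≠ 0 ↔ x ≠ 0 := by
  refine ⟨?_, fun h0 => ?_⟩
  · rintro h1 rfl
    have := H.odd₁ 0
    rw [neg_zero] at this
    exact h1 (by linarith)
  · rcases h0.lt_or_gt with h | h
    · have := H.pos₁ (-x) ⟨by linarith, by linarith [hx.1]⟩
      rw [H.odd₁] at this
      linarith
    · exact (H.pos₁ x ⟨h, hx.2.le⟩).ne'

lemma isCourantSharp_four (H : ModeTriple h μ₀ μ₁ μ₂ e₀ e₁ e₂) : IsCourantSharp h 4 := by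
  have hp := pi_pos
  have hmode := H.mode₁.tensor H.mode₁
  refine ⟨μ₁ + μ₁, H.isNthEigenvalue_four, _, hmode.contDiff.continuous.continuousOn,
    hmode.isRobinEigenfunction (not_ae_eq_zero hmode.contDiff.continuous
      (p := (π / 4, π / 4)) ⟨⟨by linarith, by linarith⟩, ⟨by linarith, by linarith⟩⟩ ?_), ?_⟩
  · have := H.pos₁ (π / 4) ⟨by linarith, by linarith⟩
    exact (mul_pos this this).ne'
  · have hcard := card_connectedComponents_of_partition
      (p := fun p : ℝ × ℝ => p ∈ square ∧ e₁ p.1 * e₁ p.2 ≠ 0)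
      (V := quadrant (Ioo 0 (π / 2) ×ˢ Ioo 0 (π / 2)))
      (isOpen_quadrant (isOpen_Ioo.prod isOpen_Ioo))
      (isPreconnected_quadrant (isPreconnected_Ioo.prod isPreconnected_Ioo))
      (nonempty_quadrant ⟨(π / 4, π / 4), ⟨by positivity, by linarith⟩,
        ⟨by positivity, by linarith⟩⟩)
      (fun i j x hi hj => quadrant_disjoint (fun p hp => ⟨hp.1.1, hp.2.1⟩) hi hj)
      (fun p => ?_)
    · simpa [nodalCount, ENat.card_eq_coe_fintype_card] using! hcard
    · constructor
      · rintro ⟨hsq, h0⟩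
        rw [mul_ne_zero_iff, H.ne_zero_iff hsq.1, H.ne_zero_iff hsq.2] at h0
        obtain ⟨i, hi⟩ := exists_sgn_mul_mem hsq.1 h0.1
        obtain ⟨j, hj⟩ := exists_sgn_mul_mem hsq.2 h0.2
        exact ⟨(i, j), hi, hj⟩
      · rintro ⟨i, hi, hj⟩
        obtain ⟨h1, h2⟩ := mem_of_sgn_mul_mem hi
        obtain ⟨h3, h4⟩ := mem_of_sgn_mul_mem hj
        exact ⟨⟨h1, h3⟩, mul_ne_zero ((H.ne_zero_iff h1).2 h2) ((H.ne_zero_iff h3).2 h4)⟩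

lemma isCourantSharp_five (H : ModeTriple h μ₀ μ₁ μ₂ e₀ e₁ e₂) : IsCourantSharp h 5 := by
  have hp := pi_pos
  have hmode := (H.mode₀.tensor H.mode₂).add (by
    simpa only [add_comm μ₂] using H.mode₂.tensor H.mode₀)
  set g : ℝ → ℝ := fun x => e₂ x / e₀ x with hg
  have hgc : Continuous g := H.continuous_ratio
  have hge : ∀ x, g (-x) = g x := fun x => by simp only [hg, H.even₀, H.even₂]
  have hga : AntitoneOn g (Icc 0 (π / 2)) := H.anti.antitoneOn
  have hcorner : g (π / 2) < 0 := H.corner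
  have hcentre : 0 < g 0 + g (π / 2) := H.centre
  have hu : ∀ p : ℝ × ℝ, e₀ p.1 * e₂ p.2 + e₂ p.1 * e₀ p.2
      = e₀ p.1 * e₀ p.2 * (g p.1 + g p.2) := fun p => by
    have h1 := (H.pos₀ p.1).ne'
    have h2 := (H.pos₀ p.2).ne'
    simp only [hg]; field_simp; ring
  have hu0 : ∀ p : ℝ × ℝ, e₀ p.1 * e₂ p.2 + e₂ p.1 * e₀ p.2 ≠ 0 ↔ g p.1 + g p.2 ≠ 0 := fun p => by
    rw [hu, mul_ne_zero_iff, and_iff_right (mul_pos (H.pos₀ _) (H.pos₀ _)).ne']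
  have hpos0 : 0 < g 0 + g 0 := by linarith
  -- Monotonicity gives `g(y) ≥ g(π/2)`, and the `centre` condition does the rest. Positivity on the
  -- axes is what separates the negative set into its four corner pieces.
  have haxis : ∀ y ∈ Ioo (-(π / 2)) (π / 2), 0 < g 0 + g y := fun y hy => by
    have hy' : |y| < π / 2 := abs_lt.2 hy
    have h1 := hga ⟨abs_nonneg y, hy'.le⟩ ⟨by positivity, le_rfl⟩ hy'.le
    have h2 : g |y| = g y := by rcases abs_choice y with h | h <;> rw [h]; exact hge y
    linarith
  refine ⟨μ₀ + μ₂, H.isNthEigenvalue_five, _, hmode.contDiff.continuous.continuousOn,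
    hmode.isRobinEigenfunction (not_ae_eq_zero hmode.contDiff.continuous
      (p := (0, 0)) ⟨⟨by simpa, by simpa⟩, ⟨by simpa, by simpa⟩⟩ ((hu0 (0, 0)).2 hpos0.ne')), ?_⟩
  set P : Set (ℝ × ℝ) := {p | p ∈ Ioo (-(π / 2)) (π / 2) ×ˢ Ioo (-(π / 2)) (π / 2) ∧
    0 < g p.1 + g p.2} with hP
  set N : Set (ℝ × ℝ) := {p | p ∈ Ioo 0 (π / 2) ×ˢ Ioo 0 (π / 2) ∧ g p.1 + g p.2 < 0} with hN
  have hNneg : ∀ i p, p ∈ quadrant N i → g p.1 + g p.2 < 0 := fun i p hp => by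
    have := hp.2
    simpa only [apply_sgn_mul hge] using this
  have hsum : Continuous fun p : ℝ × ℝ => g p.1 + g p.2 := by fun_prop
  have hPo : IsOpen P := (isOpen_Ioo.prod isOpen_Ioo).inter (isOpen_lt continuous_const hsum)
  have hNo : IsOpen N := (isOpen_Ioo.prod isOpen_Ioo).inter (isOpen_lt hsum continuous_const)
  have hNne : N.Nonempty := by
    have h1 : ∀ᶠ x in 𝓝[<] (π / 2), g x < 0 :=
      (hgc.continuousAt.eventually_lt_const hcorner).filter_mono nhdsWithin_le_nhds
    obtain ⟨x, hx1, hx2⟩ := (h1.and (Ioo_mem_nhdsLT (show 0 < π / 2 by positivity))).exists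
    exact ⟨(x, x), ⟨hx2, hx2⟩, by simp only; linarith⟩
  -- The index `none` is the single positive domain, and `some i` is the negative domain in quadrant
  -- `i`: 1 + 4 pieces.
  have hcard := card_connectedComponents_of_partition
      (p := fun p : ℝ × ℝ => p ∈ square ∧ e₀ p.1 * e₂ p.2 + e₂ p.1 * e₀ p.2 ≠ 0)
      (V := fun i : Option (Bool × Bool) => i.elim P (quadrant N)) ?_ ?_ ?_ ?_ ?_
  · simpa [nodalCount, ENat.card_eq_coe_fintype_card] using! hcard
  · rintro (_ | i)
    exacts [hPo, isOpen_quadrant hNo i]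
  · rintro (_ | i)
    exacts [isPreconnected_pos hge hga,
      isPreconnected_quadrant (isPreconnected_neg hga) i]
  · rintro (_ | i)
    exacts [⟨(0, 0), ⟨⟨by simpa, by simpa⟩, ⟨by simpa, by simpa⟩⟩, hpos0⟩,
      nonempty_quadrant hNne i]
  · rintro (_ | i) (_ | j) p hi hj
    · rfl
    · exact absurd hi.2 (hNneg j p hj).not_gt
    · exact absurd hj.2 (hNneg i p hi).not_gt
    · exact congrArg some (quadrant_disjoint (fun p hp => ⟨hp.1.1.1, hp.1.2.1⟩) hi hj)
  · intro p
    rw [hu0]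
    constructor
    · rintro ⟨hsq, h0⟩
      rcases h0.lt_or_gt with h | h
      · have h1 : p.1 ≠ 0 := fun h1 => by
          rw [h1] at h
          exact (haxis _ hsq.2).not_gt h
        have h2 : p.2 ≠ 0 := fun h2 => by
          rw [h2, add_comm] at h
          exact (haxis _ hsq.1).not_gt h
        obtain ⟨i, hi⟩ := exists_sgn_mul_mem hsq.1 h1
        obtain ⟨j, hj⟩ := exists_sgn_mul_mem hsq.2 h2
        exact ⟨some (i, j), ⟨hi, hj⟩, by simpa only [apply_sgn_mul hge] using h⟩
      · exact ⟨none, hsq, h⟩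
    · rintro ⟨_ | i, hi⟩
      · exact ⟨hi.1, (hi.2 : 0 < g p.1 + g p.2).ne'⟩
      · exact ⟨⟨(mem_of_sgn_mul_mem hi.1.1).1, (mem_of_sgn_mul_mem hi.1.2).1⟩, (hNneg i p hi).ne⟩

end ModeTriple

end RobinSquare

end

theorem theorem4 (h : ℝ) (hh : h < 0) :
    RobinSquare.IsCourantSharp h 4 ∧ RobinSquare.IsCourantSharp h 5 := by
  obtain ⟨_, _, _, _, _, _, H⟩ := RobinSquare.exists_modeTriple hh
  exact ⟨H.isCourantSharp_four, H.isCourantSharp_five⟩
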